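/- Let $K$ be a field of characteristic $0$, $n\ge 2$, and $d\in K$ with $d\notin\{0,-2,-4,\dots,-2n+4\}$ (for example $K=\mathbb{C}(d)$ with $d$ an indeterminate). The virtual Temperley–Lieb (Brauer) algebra $VTL_m(d)$ over $K$ has as basis the perfect matchings ("diagrams") of $m$ top points and $m$ bottom points; the product $XY$ of two diagrams is obtained by stacking $X$ on top of $Y$, identifying the bottom points of $X$ with the top points of $Y$, and replacing every closed curve by a factor $d$. For $1\le i\le m-1$, $e_i$ is the diagram with one arc joining the top points $i,i+1$, one arc joining the bottom points $i,i+1$, and vertical strands elsewhere, and $v_i$ is the diagram in which strands $i$ and $i+1$ cross and all other strands are vertical. Let $1_m$ be the diagram with $m$ vertical strands. The projector $f_m\in VTL_m(d)$ ($1\le m\le n$) is the last term of the sequence $f_1,\dots,f_m\in VTL_m(d)$ defined by $f_1=1_m$ and $$f_{i+1}=\tfrac{1}{i+1}\,f_i-\tfrac{2i}{(i+1)(d+2i-2)}\,f_ie_if_i+\tfrac{i}{i+1}\,f_iv_if_i\qquad(1\le i<m).$$ A $k$-element is a diagram with exactly $k$ arcs joining a top point to a bottom point. Let $0\le k\le n-2$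 with $n-k$ even. Then the canonical $k$-element $\mathcal{CE}_n^k=e_{k+1}e_{k+3}\cdots e_{n-1}$ is a single diagram of $VTL_n(d)$, with $k$ through strands; all $(k+1)$-elements of $VTL_{n-1}(d)$ (there is at least one) have the same coefficient $c$ in $f_{n-1}$; and the coefficient of $\mathcal{CE}_n^k$ in $f_n$ equals $$\left\lfloor \frac{n-k}{2}\right\rfloor\cdot\frac{-2}{n(d+2n-4)}\cdot c .$$ -/

import Mathlib

/-!
All coefficients of the projector `f_m` are known: the coefficient of a diagram depends only on its
number `b` of caps and obeys `(d + 2m - 4 - b) c (b + 2) + (b + 2) c b = 0`, starting from `1 / m!`.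
Let `F_m` be the element with these coefficients. It is fixed by the permutations of its `m`
strands, and the recursion says exactly that every hook kills it; hence `F_m F_{m+1} = F_{m+1}`
and `F_{m+1} = F_m F_{m+1} F_m`.

Expanding the middle factor over diagrams `D`, the term `F_m D F_m` vanishes as soon as an arc
joins two of the first `m` points of a row. The other diagrams are either permutations or partial
transposes (in the last strand) of permutations, so up to permutations of the first `m` strands
they are `1`, `v_m` and `e_m`. Counting them gives the recursion that defines `f_{m+1}`, whence
`f_m = F_m`, and the theorem compares `c (b + 2)` for `m + 1` with `c b` for `m`.

The loops make associativity of the product awkward to prove by hand. Instead, read a diagram as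
the indicator matrix of the colourings of the end points that are constant on arcs: with `N`
colours, stacking becomes matrix multiplication with `d = N`, and for `N` large enough the matrix
`N ^ k • D` determines both the diagram `D` and the exponent `k`.
-/

namespace VirtualTL

/-- A connection diagram on `n` strands up to virtual isotopy: a perfect matching of the `n` top
points `Sum.inl i` and the `n` bottom points `Sum.inr i`, given as a fixed-point free involution. -/
@[ext]
structure Diagram (n : ℕ) where
  mate : Equiv.Perm (Fin n ⊕ Fin n)
  mate_mate : ∀ x, mate (mate x) = x
  mate_ne : ∀ x, mate x ≠ x

/-- The number of through strands, i.e. of arcs joining a top point to a bottom point. -/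
def Diagram.through {n : ℕ} (D : Diagram n) : ℕ :=
  (Finset.univ.filter fun i : Fin n => (D.mate (Sum.inl i)).isRight = true).card

/-- The points of two stacked diagrams: top row, middle row, bottom row. -/
abbrev Stack (n : ℕ) : Type := Fin n ⊕ (Fin n ⊕ Fin n)

/-- The top and bottom points among the points of the stack. -/
def outer {n : ℕ} : Fin n ⊕ Fin n → Stack n
  | Sum.inl i => Sum.inl i
  | Sum.inr i => Sum.inr (Sum.inr i)

/-- The arcs of the diagram placed in the upper half of the stack (bottom row fixed). -/
def Diagram.upper {n : ℕ} (X : Diagram n) : Equiv.Perm (Stack n) :=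
  (Equiv.sumAssoc (Fin n) (Fin n) (Fin n)).permCongr (Equiv.sumCongr X.mate (Equiv.refl (Fin n)))

/-- The arcs of the diagram placed in the lower half of the stack (top row fixed). -/
def Diagram.lower {n : ℕ} (Y : Diagram n) : Equiv.Perm (Stack n) :=
  Equiv.sumCongr (Equiv.refl (Fin n)) Y.mate

/-- Two points of the stack of `X` on top of `Y` are related if they lie on the same connected
component of the resulting one-dimensional manifold. -/
def strand {n : ℕ} (X Y : Diagram n) : Setoid (Stack n) :=
  Relation.EqvGen.setoid fun s t => X.upper s = t ∨ Y.lower s = t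

/-- The number of closed curves created by stacking `X` on top of `Y`: the number of connected
components that contain neither a top point nor a bottom point. -/
noncomputable def loops {n : ℕ} (X Y : Diagram n) : ℕ :=
  Nat.card {c : Quotient (strand X Y) // ∀ p, Quotient.mk (strand X Y) (outer p) ≠ c}

/-- Combinatorial core of composition: a path made of alternating steps of two involutions. -/
theorem exists_end {S : Type*} [Finite S] (a b : Equiv.Perm S)
    (ha : ∀ s, a (a s) = s) (hb : ∀ s, b (b s) = s) (hab : ∀ s, ¬ (a s = s ∧ b s = s))
    (v : S) (hv : b v = v) :
    ∃ w, w ≠ v ∧ (a w = w ∨ b w = w) ∧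
      Relation.EqvGen (fun s t => a s = t ∨ b s = t) v w ∧
      ∀ u, Relation.EqvGen (fun s t => a s = t ∨ b s = t) v u → (a u = u ∨ b u = u) →
        u = v ∨ u = w := by
  set r : Equiv.Perm S := a * b with hr
  have ha2 : a * a = 1 := by ext s; simp [ha]
  have hb2 : b * b = 1 := by ext s; simp [hb]
  have ha' : a⁻¹ = a := inv_eq_of_mul_eq_one_left ha2
  have hb' : b⁻¹ = b := inv_eq_of_mul_eq_one_left hb2
  have hrinv : r⁻¹ = b * a := by rw [hr, mul_inv_rev, ha', hb']
  have hconj : ∀ k : ℤ, b * r ^ k = r ^ (-k) * b := by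
    intro k
    have h1 : b * r * b⁻¹ = r⁻¹ := by rw [hrinv, hr, hb']; rw [mul_assoc, mul_assoc, hb2, mul_one]
    have h2 : b * r ^ k * b⁻¹ = r ^ (-k) := by
      rw [← conj_zpow, h1, inv_zpow, zpow_neg]
    rw [← h2]; group
  have hbk : ∀ k : ℤ, b ((r ^ k) v) = (r ^ (-k)) v := by
    intro k
    have := congrArg (fun g : Equiv.Perm S => g v) (hconj k)
    simpa [hv] using this
  have hak : ∀ k : ℤ, a ((r ^ k) v) = (r ^ (1 - k)) v := by
    intro k
    have h1 : a = r * b := by rw [hr, mul_assoc, hb2, mul_one]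
    have h2 : a ((r ^ k) v) = r (b ((r ^ k) v)) := by
      conv_lhs => rw [h1]
      rfl
    rw [h2, hbk, sub_eq_add_neg, zpow_add, zpow_one]; rfl
  have heqv : ∀ s t : S, s = t → ∀ c, Relation.EqvGen (fun s t => a s = t ∨ b s = t) c s →
      Relation.EqvGen (fun s t => a s = t ∨ b s = t) c t := by
    rintro s t rfl c h; exact h
  have hreach : ∀ k : ℕ,
      Relation.EqvGen (fun s t => a s = t ∨ b s = t) v ((r ^ (k : ℤ)) v) := by
    intro k
    induction k with
    | zero => simpa using Relation.EqvGen.refl v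
    | succ k ih =>
      refine Relation.EqvGen.trans _ _ _ ih ?_
      refine Relation.EqvGen.trans _ (b ((r ^ (k : ℤ)) v)) _
        (Relation.EqvGen.rel _ _ (Or.inr rfl)) (Relation.EqvGen.rel _ _ (Or.inl ?_))
      rw [hbk, hak]; push_cast; congr 2; ring
  have hback : ∀ s t : S, Relation.EqvGen (fun s t => a s = t ∨ b s = t) s t →
      ((∃ k : ℤ, s = (r ^ k) v) ↔ ∃ k : ℤ, t = (r ^ k) v) := by
    intro s t h
    induction h with
    | rel s t h =>
      constructor
      · rintro ⟨k, rfl⟩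
        rcases h with h | h
        · exact ⟨1 - k, by rw [← h, hak]⟩
        · exact ⟨-k, by rw [← h, hbk]⟩
      · rintro ⟨k, rfl⟩
        rcases h with h | h
        · exact ⟨1 - k, by rw [← hak, ← h, ha]⟩
        · exact ⟨-k, by rw [← hbk, ← h, hb]⟩
    | refl s => exact Iff.rfl
    | symm s t _ ih => exact ih.symm
    | trans s t u _ _ ih1 ih2 => exact ih1.trans ih2
  set N := Function.minimalPeriod (r • ·) v with hN
  have hper : ∀ k l : ℤ, (r ^ k) v = (r ^ l) v ↔ (N : ℤ) ∣ k - l := by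
    intro k l
    rw [hN, ← MulAction.zpow_smul_eq_iff_minimalPeriod_dvd]
    rw [Equiv.Perm.smul_def, sub_eq_neg_add, zpow_add, zpow_neg, Equiv.Perm.mul_apply,
      Equiv.Perm.inv_eq_iff_eq]
  have hNpos : 0 < N := by
    rw [hN]
    refine Function.minimalPeriod_pos_of_mem_periodicPts ?_
    exact ((MulAction.injective r).mem_periodicPts v)
  have hv0 : (r ^ (0 : ℤ)) v = v := by simp
  have hN1 : N ≠ 1 := by
    intro h1
    refine hab v ⟨?_, hv⟩
    have h2 := hak 0
    rw [hv0] at h2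
    rw [h2]
    have := (hper (1 - 0) 0).2 (by rw [h1]; simp)
    rw [this, hv0]
  have hiffb : ∀ k : ℤ, b ((r ^ k) v) = (r ^ k) v ↔ (N : ℤ) ∣ 2 * k := by
    intro k
    rw [hbk, hper, ← dvd_neg]; ring_nf
  have hiffa : ∀ k : ℤ, a ((r ^ k) v) = (r ^ k) v ↔ (N : ℤ) ∣ 2 * k - 1 := by
    intro k
    rw [hak, hper, ← dvd_neg]; ring_nf
  refine ⟨(r ^ (((N + 1) / 2 : ℕ) : ℤ)) v, ?_, ?_, hreach _, ?_⟩
  · intro h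
    have h' := (hper _ 0).1 (h.trans hv0.symm)
    have h2 : N ∣ (N + 1) / 2 := by
      rw [sub_zero] at h'; exact_mod_cast h'
    have := Nat.le_of_dvd (by omega) h2
    omega
  · rcases Nat.even_or_odd' N with ⟨m, hm | hm⟩
    · right
      rw [hiffb]
      refine ⟨1, ?_⟩
      omega
    · left
      rw [hiffa]
      refine ⟨1, ?_⟩
      omega
  · intro u hu hfix
    obtain ⟨k, rfl⟩ := (hback v u hu).1 ⟨0, hv0.symm⟩
    have key : (N : ℤ) ∣ k ∨ (N : ℤ) ∣ k - (((N + 1) / 2 : ℕ) : ℤ) := by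
      rcases hfix with h | h
      · obtain ⟨q, hq⟩ := (hiffa k).1 h
        right
        rcases Nat.even_or_odd' N with ⟨m, hm | hm⟩
        · exfalso
          have : (N : ℤ) * q = 2 * (m * q) := by rw [hm]; push_cast; ring
          omega
        · have h1 : (((N + 1) / 2 : ℕ) : ℤ) = m + 1 := by omega
          rcases Int.even_or_odd' q with ⟨p, hp | hp⟩
          · exfalso
            have : (N : ℤ) * q = 2 * (N * p) := by rw [hp]; ring
            omega
          · refine ⟨p, ?_⟩
            rw [h1]
            have h2 : (N : ℤ) = 2 * m + 1 := by omega
            have : (N : ℤ) * q = 2 * (N * p) + N := by rw [hp]; ring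
            omega
      · obtain ⟨q, hq⟩ := (hiffb k).1 h
        rcases Int.even_or_odd' q with ⟨p, hp | hp⟩
        · left
          refine ⟨p, ?_⟩
          have : (N : ℤ) * q = 2 * (N * p) := by rw [hp]; ring
          omega
        · right
          refine ⟨p, ?_⟩
          have : (N : ℤ) * q = 2 * (N * p) + N := by rw [hp]; ring
          omega
    rcases key with h | h
    · left
      have := (hper k 0).2 (by simpa using h)
      rw [this, hv0]
    · right
      exact (hper _ _).2 h

theorem upper_upper {n : ℕ} (X : Diagram n) (s : Stack n) : X.upper (X.upper s) = s := by
  rcases s with i | i | i <;> simp [Diagram.upper, Equiv.permCongr_apply, X.mate_mate]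

theorem lower_lower {n : ℕ} (Y : Diagram n) (s : Stack n) : Y.lower (Y.lower s) = s := by
  rcases s with i | i | i <;> simp [Diagram.lower, Y.mate_mate]

theorem upper_fixed {n : ℕ} (X : Diagram n) (s : Stack n) :
    X.upper s = s ↔ ∃ i, s = Sum.inr (Sum.inr i) := by
  rcases s with i | i | i
  · simp only [Diagram.upper, Equiv.permCongr_apply, reduceCtorEq,
      exists_false, iff_false]
    intro h
    have h' := (Equiv.sumAssoc (Fin n) (Fin n) (Fin n)).injective
      (h.trans (Equiv.sumAssoc_apply_inl_inl i).symm)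
    simp [X.mate_ne] at h'
  · simp only [Diagram.upper, Equiv.permCongr_apply, Sum.inr.injEq, reduceCtorEq,
      exists_false, iff_false]
    intro h
    have h' := (Equiv.sumAssoc (Fin n) (Fin n) (Fin n)).injective
      (h.trans (Equiv.sumAssoc_apply_inl_inr i).symm)
    simp [X.mate_ne] at h'
  · simp [Diagram.upper, Equiv.permCongr_apply]

theorem lower_fixed {n : ℕ} (Y : Diagram n) (s : Stack n) :
    Y.lower s = s ↔ ∃ i, s = Sum.inl i := by
  rcases s with i | i
  · simp [Diagram.lower]
  · simp [Diagram.lower, Y.mate_ne]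

theorem fixed_iff_outer {n : ℕ} (X Y : Diagram n) (s : Stack n) :
    (X.upper s = s ∨ Y.lower s = s) ↔ ∃ p, outer p = s := by
  rw [upper_fixed, lower_fixed]
  constructor
  · rintro (⟨i, rfl⟩ | ⟨i, rfl⟩)
    · exact ⟨Sum.inr i, rfl⟩
    · exact ⟨Sum.inl i, rfl⟩
  · rintro ⟨i | i, rfl⟩
    · exact Or.inr ⟨i, rfl⟩
    · exact Or.inl ⟨i, rfl⟩

theorem outer_injective {n : ℕ} : Function.Injective (outer (n := n)) := by
  rintro (i | i) (j | j) h <;> simp_all [outer]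

/-- Every top or bottom point of the stack is connected to exactly one other such point. -/
theorem existsUnique_partner {n : ℕ} (X Y : Diagram n) (p : Fin n ⊕ Fin n) :
    ∃! q, q ≠ p ∧ strand X Y (outer p) (outer q) := by
  have hnot : ∀ s, ¬ (X.upper s = s ∧ Y.lower s = s) := by
    intro s
    rw [upper_fixed, lower_fixed]
    rintro ⟨⟨i, rfl⟩, ⟨j, h⟩⟩
    cases h
  have hends : ∃ w, w ≠ outer p ∧ (X.upper w = w ∨ Y.lower w = w) ∧
      strand X Y (outer p) w ∧
      ∀ u, strand X Y (outer p) u → (X.upper u = u ∨ Y.lower u = u) →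
        u = outer p ∨ u = w := by
    rcases (fixed_iff_outer X Y (outer p)).2 ⟨p, rfl⟩ with h | h
    · obtain ⟨w, h1, h2, h3, h4⟩ := exists_end Y.lower X.upper (lower_lower Y) (upper_upper X)
        (fun s hs => hnot s hs.symm) (outer p) h
      have hor : (fun s t => Y.lower s = t ∨ X.upper s = t) =
          fun s t => X.upper s = t ∨ Y.lower s = t := by
        funext s t; exact propext or_comm
      rw [hor] at h3 h4
      exact ⟨w, h1, h2.symm, h3, fun u hu hf => h4 u hu hf.symm⟩
    · exact exists_end X.upper Y.lower (upper_upper X) (lower_lower Y) hnot (outer p) h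
  obtain ⟨w, h1, h2, h3, h4⟩ := hends
  obtain ⟨q, rfl⟩ := (fixed_iff_outer X Y w).1 h2
  refine ⟨q, ⟨fun h => h1 (by rw [h]), h3⟩, ?_⟩
  rintro q' ⟨hq, hs⟩
  rcases h4 (outer q') hs ((fixed_iff_outer X Y _).2 ⟨q', rfl⟩) with h | h
  · exact absurd (outer_injective h) hq
  · exact outer_injective h

/-- The end of the strand of the stack that starts at the outer point `p`. -/
noncomputable def partner {n : ℕ} (X Y : Diagram n) (p : Fin n ⊕ Fin n) : Fin n ⊕ Fin n :=
  (existsUnique_partner X Y p).choose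

theorem partner_spec {n : ℕ} (X Y : Diagram n) (p : Fin n ⊕ Fin n) :
    partner X Y p ≠ p ∧ strand X Y (outer p) (outer (partner X Y p)) :=
  (existsUnique_partner X Y p).choose_spec.1

theorem partner_partner {n : ℕ} (X Y : Diagram n) (p : Fin n ⊕ Fin n) :
    partner X Y (partner X Y p) = p :=
  (existsUnique_partner X Y (partner X Y p)).unique (partner_spec X Y _)
    ⟨(partner_spec X Y p).1.symm, (strand X Y).symm (partner_spec X Y p).2⟩

/-- The diagram obtained by stacking `X` on top of `Y` and deleting the closed curves. -/
noncomputable def comp {n : ℕ} (X Y : Diagram n) : Diagram n where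
  mate := ⟨partner X Y, partner X Y, partner_partner X Y, partner_partner X Y⟩
  mate_mate := partner_partner X Y
  mate_ne p := (partner_spec X Y p).1

/-- The diagram whose strands join the top point `i` to the bottom point `σ i`. -/
def permDiagram {n : ℕ} (σ : Equiv.Perm (Fin n)) : Diagram n where
  mate := ⟨Sum.elim (fun i => Sum.inr (σ i)) (fun i => Sum.inl (σ.symm i)),
    Sum.elim (fun i => Sum.inr (σ i)) (fun i => Sum.inl (σ.symm i)),
    by rintro (i | i) <;> simp, by rintro (i | i) <;> simp⟩
  mate_mate := by rintro (i | i) <;> simp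
  mate_ne := by rintro (i | i) <;> simp

/-- The arc of the diagram `hookDiagram` at a point. -/
def hookMate {n : ℕ} (a b : Fin n) : Fin n ⊕ Fin n → Fin n ⊕ Fin n
  | Sum.inl i => if i = a then Sum.inl b else if i = b then Sum.inl a else Sum.inr i
  | Sum.inr i => if i = a then Sum.inr b else if i = b then Sum.inr a else Sum.inl i

theorem hookMate_hookMate {n : ℕ} (a b : Fin n) (x : Fin n ⊕ Fin n) :
    hookMate a b (hookMate a b x) = x := by
  rcases x with i | i <;> simp only [hookMate] <;> split_ifs <;> simp_all

/-- The diagram with one arc joining the top points `a`, `b`, one arc joining the bottom points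
`a`, `b`, and vertical strands elsewhere. -/
def hookDiagram {n : ℕ} (a b : Fin n) (hab : a ≠ b) : Diagram n where
  mate := ⟨hookMate a b, hookMate a b, hookMate_hookMate a b, hookMate_hookMate a b⟩
  mate_mate := hookMate_hookMate a b
  mate_ne := by
    rintro (i | i) <;> simp only [hookMate, Equiv.coe_fn_mk] <;> split_ifs <;>
      simp_all [eq_comm]

/-- The virtual Temperley-Lieb algebra `VTL_n(d)` over `K`: the free `K`-module on the
diagrams, with the multiplication below. -/
def VTL (K : Type*) [Field K] (_d : K) (n : ℕ) : Type _ := Diagram n →₀ K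

section Algebra

variable {K : Type*} [Field K] {d : K} {n : ℕ}

noncomputable instance : AddCommGroup (VTL K d n) :=
  inferInstanceAs (AddCommGroup (Diagram n →₀ K))

noncomputable instance : Module K (VTL K d n) :=
  inferInstanceAs (Module K (Diagram n →₀ K))

/-- The basis element of `VTL_n(d)` given by a diagram. -/
noncomputable def ofDiagram (D : Diagram n) : VTL K d n := Finsupp.single D (1 : K)

/-- The coefficient of a diagram in an element of `VTL_n(d)`. -/
def coeff (f : VTL K d n) (D : Diagram n) : K := (show Diagram n →₀ K from f) D

/-- The bilinear multiplication with `X * Y = d ^ loops X Y • comp X Y` on diagrams. -/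
noncomputable instance : Mul (VTL K d n) where
  mul f g := Finsupp.sum (show Diagram n →₀ K from f) fun X s =>
    Finsupp.sum (show Diagram n →₀ K from g) fun Y t =>
      (s * t * d ^ loops X Y) • (ofDiagram (comp X Y) : VTL K d n)

/-- The unit `1_n`: the diagram with `n` vertical strands. -/
noncomputable instance : One (VTL K d n) where
  one := ofDiagram (permDiagram 1)

end Algebra

section Projectors

variable {K : Type*} [Field K] (d : K) (n : ℕ)

/-- The generator `e_i` of `VTL_n(d)`, `1 ≤ i ≤ n - 1` (and `0` for other `i`); the points of a
row are numbered `1, …, n` in the text and `0, …, n - 1` in `Fin n`. -/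
noncomputable def e (i : ℕ) : VTL K d n :=
  if h : 1 ≤ i ∧ i < n then
    ofDiagram (hookDiagram ⟨i - 1, by omega⟩ ⟨i, h.2⟩ (by simp [Fin.ext_iff]; omega))
  else 0

/-- The virtual generator `v_i` of `VTL_n(d)`, `1 ≤ i ≤ n - 1` (and `0` for other `i`): the
strands `i` and `i + 1` cross. -/
noncomputable def v (i : ℕ) : VTL K d n :=
  if h : 1 ≤ i ∧ i < n then
    ofDiagram (permDiagram (Equiv.swap ⟨i - 1, by omega⟩ ⟨i, h.2⟩))
  else 0

/-- `x_i = 1 / (i + 1)`. -/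
noncomputable def xCoeff (K : Type*) [Field K] (i : ℕ) : K := 1 / ((i : K) + 1)

/-- `y_i = - 2 i / ((i + 1) (d + 2 i - 2))`. -/
noncomputable def yCoeff (i : ℕ) : K := -(2 * (i : K)) / (((i : K) + 1) * (d + 2 * (i : K) - 2))

/-- `z_i = i / (i + 1)`. -/
noncomputable def zCoeff (K : Type*) [Field K] (i : ℕ) : K := (i : K) / ((i : K) + 1)

/-- The elements `f_i` of `VTL_n(d)`, for `1 ≤ i ≤ n`: `f_1 = 1_n` and
`f_{i+1} = x_i f_i + y_i f_i e_i f_i + z_i f_i v_i f_i`. The value at `i = 0` is irrelevant. -/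
noncomputable def projStep : ℕ → VTL K d n
  | 0 => 1
  | 1 => 1
  | i + 2 =>
    xCoeff K (i + 1) • projStep (i + 1)
      + yCoeff d (i + 1) • (projStep (i + 1) * e d n (i + 1) * projStep (i + 1))
      + zCoeff K (i + 1) • (projStep (i + 1) * v d n (i + 1) * projStep (i + 1))

/-- The projector `f_n` of `VTL_n(d)`. -/
noncomputable def proj : VTL K d n := projStep d n n

/-- The canonical `k`-element `e_{k+1} e_{k+3} ⋯ e_{n-1}` of `VTL_n(d)`
(for `k < n` with `n - k` even). -/
noncomputable def canonicalElement (k : ℕ) : VTL K d n :=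
  ((List.range ((n - k) / 2)).map fun j => e d n (k + 1 + 2 * j)).prod

variable {d n}

/-- `c` is the common coefficient in `f` of the `k`-elements of `VTL_n(d)`, that is, of the
diagrams with exactly `k` through strands. -/
def IsCommonCoeff (f : VTL K d n) (k : ℕ) (c : K) : Prop :=
  (∃ X : Diagram n, X.through = k) ∧ ∀ X : Diagram n, X.through = k → coeff f X = c

end Projectors

end VirtualTL

namespace VirtualTL

open Equiv (swap)

variable {n : ℕ}

theorem Diagram.mate_injective : Function.Injective (Diagram.mate (n := n)) := fun _ _ h =>
  Diagram.ext h

theorem Diagram.ext_mate {D E : Diagram n} (h : ∀ x, D.mate x = E.mate x) : D = E :=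
  Diagram.ext (Equiv.ext h)

theorem Diagram.mate_eq_comm (D : Diagram n) {x y : Fin n ⊕ Fin n} :
    D.mate x = y ↔ D.mate y = x := by
  constructor <;> rintro rfl <;> exact D.mate_mate _

noncomputable instance : Fintype (Diagram n) :=
  Fintype.ofInjective _ Diagram.mate_injective

noncomputable instance : DecidableEq (Diagram n) := Classical.decEq _

/-- Permutations of the end points act on diagrams by transport of the arcs. -/
instance : MulAction (Equiv.Perm (Fin n ⊕ Fin n)) (Diagram n) where
  smul π D :=
    { mate := π * D.mate * π⁻¹
      mate_mate := fun x => by simp [D.mate_mate]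
      mate_ne := fun x h => D.mate_ne (π⁻¹ x) (Equiv.Perm.eq_inv_iff_eq.2 h) }
  one_smul D := Diagram.ext_mate fun _ => rfl
  mul_smul π ρ D := Diagram.ext_mate fun x =>
    congrArg (fun τ : Equiv.Perm (Fin n ⊕ Fin n) => π (ρ (D.mate (τ x)))) (mul_inv_rev π ρ)

theorem Diagram.smul_mate (π : Equiv.Perm (Fin n ⊕ Fin n)) (D : Diagram n) (x : Fin n ⊕ Fin n) :
    (π • D).mate x = π (D.mate (π⁻¹ x)) := rfl

theorem Diagram.smul_mate_eq_iff {π : Equiv.Perm (Fin n ⊕ Fin n)} {D : Diagram n}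
    {x y : Fin n ⊕ Fin n} : (π • D).mate (π x) = π y ↔ D.mate x = y := by
  simp [smul_mate]

@[simp]
theorem permDiagram_mate_inl (σ : Equiv.Perm (Fin n)) (i : Fin n) :
    (permDiagram σ).mate (Sum.inl i) = Sum.inr (σ i) := rfl

@[simp]
theorem permDiagram_mate_inr (σ : Equiv.Perm (Fin n)) (i : Fin n) :
    (permDiagram σ).mate (Sum.inr i) = Sum.inl (σ⁻¹ i) := rfl

theorem permDiagram_injective : Function.Injective (permDiagram (n := n)) := fun _ _ h =>
  Equiv.ext fun i => Sum.inr_injective (congrArg (fun D : Diagram n => D.mate (Sum.inl i)) h)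

theorem sumCongr_smul_permDiagram (ρ τ σ : Equiv.Perm (Fin n)) :
    Equiv.Perm.sumCongr ρ τ • permDiagram σ = permDiagram (τ * σ * ρ⁻¹) := by
  refine Diagram.ext_mate ?_
  rintro (i | i) <;> simp [Diagram.smul_mate]

theorem hookDiagram_mate {a b : Fin n} (hab : a ≠ b) (x : Fin n ⊕ Fin n) :
    (hookDiagram a b hab).mate x = hookMate a b x := rfl

/-- The reflection of a diagram in a horizontal line. -/
def flip (D : Diagram n) : Diagram n :=
  (Equiv.sumComm (Fin n) (Fin n) : Equiv.Perm (Fin n ⊕ Fin n)) • D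

theorem flip_mate (D : Diagram n) (x : Fin n ⊕ Fin n) :
    (flip D).mate x = (D.mate x.swap).swap := rfl

theorem flip_mate_inl_eq_inl {D : Diagram n} {a b : Fin n} :
    (flip D).mate (Sum.inl a) = Sum.inl b ↔ D.mate (Sum.inr a) = Sum.inr b :=
  (Equiv.eq_symm_apply (Equiv.sumComm (Fin n) (Fin n))).symm

@[simp]
theorem flip_flip (D : Diagram n) : flip (flip D) = D :=
  Diagram.ext_mate fun x => by simp [flip_mate]

@[simp]
theorem flip_permDiagram (σ : Equiv.Perm (Fin n)) :
    flip (permDiagram σ) = permDiagram σ⁻¹ := by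
  refine Diagram.ext_mate ?_
  rintro (i | i) <;> simp [flip_mate]

@[simp]
theorem flip_hookDiagram {a b : Fin n} (hab : a ≠ b) :
    flip (hookDiagram a b hab) = hookDiagram a b hab := by
  refine Diagram.ext_mate ?_
  rintro (i | i) <;> simp only [flip_mate, hookDiagram_mate, Sum.swap_inl, Sum.swap_inr,
    hookMate] <;> split_ifs <;> rfl

section Strand

variable (X Y : Diagram n)

theorem strand_upper (s : Stack n) : strand X Y s (X.upper s) :=
  Relation.EqvGen.rel _ _ (Or.inl rfl)

theorem strand_lower (s : Stack n) : strand X Y s (Y.lower s) :=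
  Relation.EqvGen.rel _ _ (Or.inr rfl)

theorem strand_inr (q : Fin n ⊕ Fin n) : strand X Y (Sum.inr q) (Sum.inr (Y.mate q)) :=
  strand_lower X Y (Sum.inr q)

/-- The points of the upper diagram among the points of the stack. -/
def upperPoint : Fin n ⊕ Fin n → Stack n
  | Sum.inl i => Sum.inl i
  | Sum.inr i => Sum.inr (Sum.inl i)

@[simp]
theorem upper_upperPoint (p : Fin n ⊕ Fin n) :
    X.upper (upperPoint p) = upperPoint (X.mate p) := by
  rcases p with i | i <;>
    simp only [Diagram.upper, upperPoint, Equiv.permCongr_apply, Equiv.sumAssoc_symm_apply_inl,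
      Equiv.sumAssoc_symm_apply_inr_inl, Equiv.sumCongr_apply, Sum.map_inl]
  · rcases X.mate (Sum.inl i) with j | j <;> rfl
  · rcases X.mate (Sum.inr i) with j | j <;> rfl

@[simp]
theorem upper_inr_inr (i : Fin n) : X.upper (Sum.inr (Sum.inr i)) = Sum.inr (Sum.inr i) :=
  (upper_fixed X _).2 ⟨i, rfl⟩

theorem strand_upperPoint (p : Fin n ⊕ Fin n) :
    strand X Y (upperPoint p) (upperPoint (X.mate p)) := by
  rw [← upper_upperPoint]
  exact strand_upper X Y _

theorem strand_comp (p : Fin n ⊕ Fin n) :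
    strand X Y (outer p) (outer ((comp X Y).mate p)) := (partner_spec X Y p).2

variable {X Y}

theorem strand_outer_iff {p q : Fin n ⊕ Fin n} :
    strand X Y (outer p) (outer q) ↔ q = p ∨ q = (comp X Y).mate p := by
  refine ⟨fun h => or_iff_not_imp_left.2 fun hq =>
    (existsUnique_partner X Y p).unique ⟨hq, h⟩ (partner_spec X Y p), ?_⟩
  rintro (rfl | rfl)
  exacts [(strand X Y).refl _, strand_comp X Y p]

theorem comp_eq_of_strand {Z : Diagram n}
    (h : ∀ p, strand X Y (outer p) (outer (Z.mate p))) : comp X Y = Z :=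
  Diagram.ext_mate fun p => ((strand_outer_iff.1 (h p)).resolve_left (Z.mate_ne p)).symm

theorem loops_eq_zero (h : ∀ q, ∃ p, strand X Y (outer p) (Sum.inr q)) : loops X Y = 0 := by
  refine Nat.card_eq_zero.2 (Or.inl ⟨?_⟩)
  rintro ⟨⟨i | q⟩, hc⟩
  · exact hc (Sum.inl i) rfl
  · obtain ⟨p, hp⟩ := h q
    exact hc p (Quotient.sound hp)

theorem mem_iff_mem_of_strand {S : Set (Stack n)} (hX : ∀ s ∈ S, X.upper s ∈ S)
    (hY : ∀ s ∈ S, Y.lower s ∈ S) {s t : Stack n} (h : strand X Y s t) : s ∈ S ↔ t ∈ S := by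
  replace h : Relation.EqvGen (fun s t => X.upper s = t ∨ Y.lower s = t) s t := h
  induction h with
  | rel s t h =>
    rcases h with rfl | rfl
    · exact ⟨hX s, fun h => by simpa only [upper_upper] using hX _ h⟩
    · exact ⟨hY s, fun h => by simpa only [lower_lower] using hY _ h⟩
  | refl s => exact Iff.rfl
  | symm s t _ ih => exact ih.symm
  | trans s t u _ _ ih₁ ih₂ => exact ih₁.trans ih₂

end Strand

section PermComp

variable (σ : Equiv.Perm (Fin n)) (D : Diagram n)

theorem strand_permDiagram_outer (p : Fin n ⊕ Fin n) :
    strand (permDiagram σ) D (outer p) (Sum.inr (Equiv.Perm.sumCongr σ 1 p)) := by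
  rcases p with i | i
  exacts [strand_upperPoint (permDiagram σ) D (Sum.inl i), (strand _ _).refl _]

theorem comp_permDiagram :
    comp (permDiagram σ) D = (Equiv.Perm.sumCongr σ (1 : Equiv.Perm (Fin n)))⁻¹ • D := by
  refine comp_eq_of_strand fun p => ?_
  set π : Equiv.Perm (Fin n ⊕ Fin n) := Equiv.Perm.sumCongr σ 1
  have hend := strand_permDiagram_outer σ D ((π⁻¹ • D).mate p)
  rw [Diagram.smul_mate, inv_inv, Equiv.Perm.coe_inv, Equiv.apply_symm_apply] at hend
  exact (strand _ _).trans ((strand _ _).trans (strand_permDiagram_outer σ D p)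
    (strand_inr _ _ _)) ((strand _ _).symm hend)

theorem loops_permDiagram : loops (permDiagram σ) D = 0 :=
  loops_eq_zero fun q => ⟨(Equiv.Perm.sumCongr σ 1).symm q, by
    simpa only [Equiv.apply_symm_apply] using
      strand_permDiagram_outer σ D ((Equiv.Perm.sumCongr σ 1).symm q)⟩

end PermComp

section HookComp

variable {a b : Fin n} (hab : a ≠ b) (D : Diagram n)

theorem strand_hookDiagram_outer {p : Fin n ⊕ Fin n} (ha : p ≠ Sum.inl a) (hb : p ≠ Sum.inl b) :
    strand (hookDiagram a b hab) D (outer p) (Sum.inr p) := by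
  rcases p with i | i
  · have h := strand_upperPoint (hookDiagram a b hab) D (Sum.inl i)
    rwa [hookDiagram_mate, hookMate, if_neg (by simpa using ha), if_neg (by simpa using hb)] at h
  · exact (strand _ _).refl _

theorem strand_hookDiagram_top :
    strand (hookDiagram a b hab) D (Sum.inl a) (Sum.inl b) := by
  have h := strand_upperPoint (hookDiagram a b hab) D (Sum.inl a)
  rwa [hookDiagram_mate, hookMate, if_pos rfl] at h

theorem strand_hookDiagram_middle :
    strand (hookDiagram a b hab) D (Sum.inr (Sum.inl a)) (Sum.inr (Sum.inl b)) := by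
  have h := strand_upperPoint (hookDiagram a b hab) D (Sum.inr a)
  rwa [hookDiagram_mate, hookMate, if_pos rfl] at h

theorem strand_hookDiagram_swap_outer {p : Fin n ⊕ Fin n} (ha : p ≠ Sum.inl a)
    (hp : p ≠ D.mate (Sum.inl a)) :
    strand (hookDiagram a b hab) D (outer (swap (Sum.inl b) (D.mate (Sum.inl a)) p))
      (Sum.inr p) := by
  rcases eq_or_ne p (Sum.inl b) with rfl | hb
  · rw [Equiv.swap_apply_left]
    refine (strand _ _).trans (strand_hookDiagram_outer hab D (D.mate_ne _) hp.symm) ?_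
    exact (strand _ _).trans ((strand _ _).symm (strand_inr _ _ _))
      (strand_hookDiagram_middle hab D)
  · rw [Equiv.swap_apply_of_ne_of_ne hb hp]
    exact strand_hookDiagram_outer hab D ha hb

theorem comp_hookDiagram :
    comp (hookDiagram a b hab) D = swap (Sum.inl b) (D.mate (Sum.inl a)) • D := by
  set S := swap (Sum.inl b) (D.mate (Sum.inl a)) with hS
  suffices h : ∀ p, strand (hookDiagram a b hab) D (outer (S p)) (outer (S (D.mate p))) from
    comp_eq_of_strand fun p => by
      simpa only [Diagram.smul_mate, Equiv.Perm.coe_inv, Equiv.apply_symm_apply] using h (S⁻¹ p)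
  have hSa : S (Sum.inl a) = Sum.inl a :=
    Equiv.swap_apply_of_ne_of_ne (by simpa using hab) (D.mate_ne _).symm
  intro p
  by_cases ha : p = Sum.inl a
  · rw [ha, hSa, hS, Equiv.swap_apply_right]
    exact strand_hookDiagram_top hab D
  by_cases hx : p = D.mate (Sum.inl a)
  · rw [hx, D.mate_mate, hSa, hS, Equiv.swap_apply_right]
    exact (strand _ _).symm (strand_hookDiagram_top hab D)
  refine (strand _ _).trans (strand_hookDiagram_swap_outer hab D ha hx) ?_
  refine (strand _ _).trans (strand_inr _ _ p) ((strand _ _).symm ?_)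
  exact strand_hookDiagram_swap_outer hab D (fun h => hx (D.mate_eq_comm.1 h).symm)
    fun h => ha (D.mate.injective h)

theorem loops_hookDiagram_of_ne (h : D.mate (Sum.inl a) ≠ Sum.inl b) :
    loops (hookDiagram a b hab) D = 0 := by
  have hend : ∃ p, strand (hookDiagram a b hab) D (outer p) (Sum.inr (Sum.inl a)) :=
    ⟨D.mate (Sum.inl a), (strand _ _).trans (strand_hookDiagram_outer hab D (D.mate_ne _) h)
      ((strand _ _).symm (strand_inr _ _ _))⟩
  refine loops_eq_zero fun q => ?_
  by_cases ha : q = Sum.inl a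
  · exact ha ▸ hend
  by_cases hb : q = Sum.inl b
  · obtain ⟨p, hp⟩ := hend
    exact ⟨p, hb ▸ (strand _ _).trans hp (strand_hookDiagram_middle hab D)⟩
  · exact ⟨q, strand_hookDiagram_outer hab D ha hb⟩

theorem loops_hookDiagram_of_eq (h : D.mate (Sum.inl a) = Sum.inl b) :
    loops (hookDiagram a b hab) D = 1 := by
  let loop : Set (Stack n) := {Sum.inr (Sum.inl a), Sum.inr (Sum.inl b)}
  have hX : ∀ s ∈ loop, (hookDiagram a b hab).upper s ∈ loop := by
    rintro s (rfl | rfl)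
    · have := upper_upperPoint (hookDiagram a b hab) (Sum.inr a)
      exact Or.inr (by rwa [hookDiagram_mate, hookMate, if_pos rfl] at this)
    · have := upper_upperPoint (hookDiagram a b hab) (Sum.inr b)
      exact Or.inl (by rwa [hookDiagram_mate, hookMate, if_neg hab.symm, if_pos rfl] at this)
  have hY : ∀ s ∈ loop, D.lower s ∈ loop := by
    rintro s (rfl | rfl)
    · exact Or.inr (congrArg Sum.inr h)
    · exact Or.inl (congrArg Sum.inr (D.mate_eq_comm.1 h))
  refine Nat.card_eq_one_iff_exists.2 ⟨⟨Quotient.mk _ (Sum.inr (Sum.inl a)), fun p hp => ?_⟩, ?_⟩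
  · have := (mem_iff_mem_of_strand hX hY (Quotient.exact hp)).2 (Or.inl rfl)
    rcases p with i | i <;> simp [loop, outer] at this
  rintro ⟨⟨i | q⟩, hc⟩
  · exact absurd rfl (hc (Sum.inl i))
  refine Subtype.ext (Quotient.sound ?_)
  by_cases ha : q = Sum.inl a
  · exact ha ▸ (strand _ _).refl _
  by_cases hb : q = Sum.inl b
  · exact hb ▸ (strand _ _).symm (strand_hookDiagram_middle hab D)
  · exact absurd (Quotient.sound (strand_hookDiagram_outer hab D ha hb)) (hc q)

end HookComp

section Colouring

variable {C : Type*}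

/-- The matrix of a diagram on colourings of the top and bottom points: the entry is `1` if every
arc is monochromatic and `0` otherwise. -/
noncomputable def colourMatrix (C : Type*) (D : Diagram n) :
    Matrix (Fin n → C) (Fin n → C) ℕ :=
  open Classical in fun s t => if ∀ x, Sum.elim s t (D.mate x) = Sum.elim s t x then 1 else 0

theorem elim_upperPoint (s u t : Fin n → C) (p : Fin n ⊕ Fin n) :
    Sum.elim s (Sum.elim u t) (upperPoint p) = Sum.elim s u p := by
  rcases p with i | i <;> rfl

theorem elim_outer (s u t : Fin n → C) (p : Fin n ⊕ Fin n) :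
    Sum.elim s (Sum.elim u t) (outer p) = Sum.elim s t p := by
  rcases p with i | i <;> rfl

theorem elim_eq_of_strand {X Y : Diagram n} {s u t : Fin n → C}
    (hX : ∀ x, Sum.elim s u (X.mate x) = Sum.elim s u x)
    (hY : ∀ x, Sum.elim u t (Y.mate x) = Sum.elim u t x) {x y : Stack n} (h : strand X Y x y) :
    Sum.elim s (Sum.elim u t) x = Sum.elim s (Sum.elim u t) y := by
  have hup : ∀ p, Sum.elim s (Sum.elim u t) (X.upper (upperPoint p)) =
      Sum.elim s (Sum.elim u t) (upperPoint p) := fun p => by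
    rw [upper_upperPoint, elim_upperPoint, elim_upperPoint, hX]
  have hupper : ∀ z, Sum.elim s (Sum.elim u t) (X.upper z) = Sum.elim s (Sum.elim u t) z := by
    rintro (i | i | i)
    exacts [hup (Sum.inl i), hup (Sum.inr i), by rw [upper_inr_inr]]
  have hlower : ∀ z, Sum.elim s (Sum.elim u t) (Y.lower z) = Sum.elim s (Sum.elim u t) z := by
    rintro (i | p)
    exacts [rfl, hY p]
  exact (mem_iff_mem_of_strand
    (S := {z | Sum.elim s (Sum.elim u t) z = Sum.elim s (Sum.elim u t) y})
    (fun z hz => (hupper z).trans hz) (fun z hz => (hlower z).trans hz) h).2 rfl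

/-- Colourings of the middle row compatible with `X` above and `Y` below, the outer rows being
coloured by `s` and `t`, are colourings of the strands extending `s` and `t`. -/
def middleColouringEquiv (X Y : Diagram n) (s t : Fin n → C) :
    {u : Fin n → C // (∀ x, Sum.elim s u (X.mate x) = Sum.elim s u x) ∧
      ∀ x, Sum.elim u t (Y.mate x) = Sum.elim u t x} ≃
    {f : Quotient (strand X Y) → C // ∀ p, f (Quotient.mk _ (outer p)) = Sum.elim s t p} where
  toFun u := ⟨Quotient.lift (Sum.elim s (Sum.elim u.1 t)) fun _ _ h =>
    elim_eq_of_strand u.2.1 u.2.2 h, elim_outer s u.1 t⟩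
  invFun f := ⟨fun i => f.1 (Quotient.mk _ (Sum.inr (Sum.inl i))), by
    have hup : ∀ p, Sum.elim s (fun i => f.1 (Quotient.mk _ (Sum.inr (Sum.inl i)))) p =
        f.1 (Quotient.mk _ (upperPoint p)) := by
      rintro (i | i)
      exacts [(f.2 (Sum.inl i)).symm, rfl]
    have hlow : ∀ p, Sum.elim (fun i => f.1 (Quotient.mk _ (Sum.inr (Sum.inl i)))) t p =
        f.1 (Quotient.mk _ (Sum.inr p)) := by
      rintro (i | i)
      exacts [rfl, (f.2 (Sum.inr i)).symm]
    refine ⟨fun x => ?_, fun x => ?_⟩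
    · rw [hup, hup, Quotient.sound (strand_upperPoint X Y x)]
    · rw [hlow, hlow, Quotient.sound (strand_inr X Y x)]⟩
  left_inv _ := rfl
  right_inv f := by
    refine Subtype.ext (funext (Quotient.ind ?_))
    rintro (i | i | i)
    exacts [(f.2 (Sum.inl i)).symm, rfl, (f.2 (Sum.inr i)).symm]

theorem card_strandColourings {X Y : Diagram n} {s t : Fin n → C}
    (h : ∀ x, Sum.elim s t ((comp X Y).mate x) = Sum.elim s t x) :
    Nat.card {f : Quotient (strand X Y) → C //
      ∀ p, f (Quotient.mk _ (outer p)) = Sum.elim s t p} = Nat.card C ^ loops X Y := by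
  classical
  have hst : ∀ p q, strand X Y (outer p) (outer q) → Sum.elim s t p = Sum.elim s t q := by
    intro p q hpq
    rcases strand_outer_iff.1 hpq with rfl | rfl
    exacts [rfl, (h p).symm]
  let f₀ : {c // ∃ p, Quotient.mk (strand X Y) (outer p) = c} → C := fun c =>
    Sum.elim s t c.2.choose
  have hf₀ : ∀ f : Quotient (strand X Y) → C,
      (∀ p, f (Quotient.mk _ (outer p)) = Sum.elim s t p) ↔ f ∘ Subtype.val = f₀ := by
    refine fun f => ⟨fun hf => funext fun c => ?_, fun hf p => ?_⟩
    · rw [Function.comp_apply, ← c.2.choose_spec, hf]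
    · have hp : ∃ q, Quotient.mk (strand X Y) (outer q) = Quotient.mk (strand X Y) (outer p) :=
        ⟨p, rfl⟩
      exact (congrFun hf ⟨_, hp⟩).trans (hst _ _ (Quotient.exact hp.choose_spec))
  rw [Nat.card_congr ((Equiv.subtypeEquivRight hf₀).trans (Equiv.subtypePreimage _ f₀)),
    Nat.card_fun, loops]
  simp only [not_exists, ne_eq]

theorem colourMatrix_mul [Fintype C] (X Y : Diagram n) :
    colourMatrix C X * colourMatrix C Y =
      Fintype.card C ^ loops X Y • colourMatrix C (comp X Y) := by
  classical
  ext s t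
  rw [Matrix.mul_apply, Matrix.smul_apply]
  simp only [colourMatrix, ite_mul, one_mul, zero_mul, ← ite_and]
  rw [Finset.sum_boole, Nat.cast_id, ← Fintype.card_subtype, ← Nat.card_eq_fintype_card]
  split_ifs with h
  · rw [smul_eq_mul, mul_one, ← Nat.card_eq_fintype_card (α := C), ← card_strandColourings h]
    exact Nat.card_congr (middleColouringEquiv X Y s t)
  · refine Nat.card_eq_zero.2 (Or.inl ⟨fun ⟨u, hX, hY⟩ => h fun x => ?_⟩)
    rw [← elim_outer s u t, ← elim_outer s u t]
    exact (elim_eq_of_strand hX hY (strand_comp X Y x)).symm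

theorem colourMatrix_flip (D : Diagram n) :
    colourMatrix C (flip D) = (colourMatrix C D).transpose := by
  classical
  ext s t
  have hswap : ∀ x : Fin n ⊕ Fin n, Sum.elim s t x.swap = Sum.elim t s x := by
    rintro (i | i) <;> rfl
  have hiff : (∀ x, Sum.elim s t ((flip D).mate x) = Sum.elim s t x) ↔
      ∀ x, Sum.elim t s (D.mate x) = Sum.elim t s x :=
    (Equiv.sumComm (Fin n) (Fin n)).forall_congr fun {x} => by
      rw [flip_mate, hswap, ← Sum.swap_swap x, hswap]
      simp only [Equiv.sumComm_apply, Sum.swap_swap]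
  rw [Matrix.transpose_apply, colourMatrix, colourMatrix]
  exact if_congr hiff rfl rfl

/-- A set of at least two colours, sufficiently many to distinguish all diagrams on `n` strands. -/
abbrev Palette (n : ℕ) : Type := Sym2 (Fin n ⊕ Fin n) ⊕ Bool

theorem one_lt_card_palette (n : ℕ) : 1 < Fintype.card (Palette n) := by
  rw [Fintype.card_sum, Fintype.card_bool]
  lia

theorem exists_colouring_iff_eq (D : Diagram n) :
    ∃ s t : Fin n → Palette n,
      ∀ E : Diagram n, (∀ x, Sum.elim s t (E.mate x) = Sum.elim s t x) ↔ E = D := by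
  let c : Fin n ⊕ Fin n → Palette n := fun x => Sum.inl s(x, D.mate x)
  refine ⟨c ∘ Sum.inl, c ∘ Sum.inr, fun E => ?_⟩
  rw [Sum.elim_comp_inl_inr]
  constructor
  · intro h
    refine Diagram.ext_mate fun x => ?_
    rcases Sym2.eq_iff.1 (Sum.inl_injective (h x)) with ⟨hx, -⟩ | ⟨hx, -⟩
    exacts [absurd hx (E.mate_ne x), hx]
  · rintro rfl x
    simp only [c, E.mate_mate, Sym2.eq_swap]

theorem eq_and_eq_of_pow_smul_colourMatrix_eq {X Y : Diagram n} {k l : ℕ}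
    (h : Fintype.card (Palette n) ^ k • colourMatrix (Palette n) X =
      Fintype.card (Palette n) ^ l • colourMatrix (Palette n) Y) : X = Y ∧ k = l := by
  obtain ⟨s, t, hst⟩ := exists_colouring_iff_eq X
  have hentry := congrFun (congrFun h s) t
  simp only [Matrix.smul_apply, colourMatrix, hst, if_true, smul_eq_mul, mul_one] at hentry
  have hpos := pow_pos (zero_lt_one.trans (one_lt_card_palette n)) k
  split_ifs at hentry with hYX
  · exact ⟨hYX.symm, Nat.pow_right_injective (one_lt_card_palette n) (by simpa using hentry)⟩
  · exact absurd hentry hpos.ne'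

theorem comp_assoc_and_loops_add (X Y Z : Diagram n) :
    comp (comp X Y) Z = comp X (comp Y Z) ∧
      loops X Y + loops (comp X Y) Z = loops Y Z + loops X (comp Y Z) := by
  have h := Matrix.mul_assoc (colourMatrix (Palette n) X) (colourMatrix (Palette n) Y)
    (colourMatrix (Palette n) Z)
  simp only [colourMatrix_mul, Matrix.smul_mul, Matrix.mul_smul, smul_smul, ← pow_add] at h
  exact eq_and_eq_of_pow_smul_colourMatrix_eq h

theorem flip_comp_and_loops_flip (X Y : Diagram n) :
    flip (comp X Y) = comp (flip Y) (flip X) ∧ loops X Y = loops (flip Y) (flip X) := by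
  have h := Matrix.transpose_mul (colourMatrix (Palette n) X) (colourMatrix (Palette n) Y)
  simp only [colourMatrix_mul, Matrix.transpose_smul, ← colourMatrix_flip] at h
  exact eq_and_eq_of_pow_smul_colourMatrix_eq h

end Colouring

section Algebra

variable {K : Type*} [Field K] {d : K}

theorem VTL.ext {f g : VTL K d n} (h : ∀ D, coeff f D = coeff g D) : f = g := Finsupp.ext h

@[simp]
theorem coeff_add (f g : VTL K d n) (D : Diagram n) :
    coeff (f + g) D = coeff f D + coeff g D := rfl

@[simp]
theorem coeff_smul (r : K) (f : VTL K d n) (D : Diagram n) :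
    coeff (r • f) D = r * coeff f D := rfl

theorem coeff_sum {ι : Type*} (s : Finset ι) (f : ι → VTL K d n) (D : Diagram n) :
    coeff (∑ i ∈ s, f i) D = ∑ i ∈ s, coeff (f i) D :=
  Finsupp.finsetSum_apply (N := K) s f D

theorem coeff_ofDiagram (X D : Diagram n) :
    coeff (ofDiagram X : VTL K d n) D = if X = D then 1 else 0 :=
  Finsupp.single_apply

@[simp]
theorem coeff_sum_smul_ofDiagram (c : Diagram n → K) (D : Diagram n) :
    coeff (∑ X, c X • ofDiagram X : VTL K d n) D = c D := by
  simp [coeff_sum, coeff_ofDiagram]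

theorem VTL.eq_sum (f : VTL K d n) : f = ∑ D, coeff f D • ofDiagram D :=
  VTL.ext fun E => (coeff_sum_smul_ofDiagram (coeff f) E).symm

theorem VTL.induction_linear {p : VTL K d n → Prop} (f : VTL K d n) (zero : p 0)
    (add : ∀ f g, p f → p g → p (f + g)) (smul : ∀ (r : K) D, p (r • ofDiagram D)) : p f := by
  rw [VTL.eq_sum f]
  exact Finset.sum_induction _ p add zero fun D _ => smul _ _

theorem VTL.mul_eq_sum (f g : VTL K d n) :
    f * g = ∑ X, ∑ Y, (coeff f X * coeff g Y * d ^ loops X Y) • ofDiagram (comp X Y) :=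
  (Finsupp.sum_fintype _ _ fun _ => by simp [Finsupp.sum]).trans <|
    Finset.sum_congr rfl fun _ _ => Finsupp.sum_fintype _ _ fun _ => by simp

noncomputable instance : NonUnitalNonAssocRing (VTL K d n) :=
  { (inferInstance : AddCommGroup (VTL K d n)), (inferInstance : Mul (VTL K d n)) with
    left_distrib := fun f g h => by
      simp only [VTL.mul_eq_sum, coeff_add, mul_add, add_mul, add_smul, Finset.sum_add_distrib]
    right_distrib := fun f g h => by
      simp only [VTL.mul_eq_sum, coeff_add, add_mul, add_smul, Finset.sum_add_distrib]
    zero_mul := fun f => by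
      simp only [VTL.mul_eq_sum, show ∀ D, coeff (0 : VTL K d n) D = 0 from fun _ => rfl,
        zero_mul, zero_smul, Finset.sum_const_zero]
    mul_zero := fun f => by
      simp only [VTL.mul_eq_sum, show ∀ D, coeff (0 : VTL K d n) D = 0 from fun _ => rfl,
        mul_zero, zero_mul, zero_smul, Finset.sum_const_zero] }

instance : IsScalarTower K (VTL K d n) (VTL K d n) :=
  ⟨fun r f g => by
    simp only [smul_eq_mul, VTL.mul_eq_sum, coeff_smul, Finset.smul_sum, smul_smul, mul_assoc]⟩

instance : SMulCommClass K (VTL K d n) (VTL K d n) :=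
  ⟨fun r f g => by
    simp only [smul_eq_mul, VTL.mul_eq_sum, coeff_smul, Finset.smul_sum, smul_smul, mul_assoc,
      mul_left_comm r]⟩

theorem ofDiagram_mul_ofDiagram (X Y : Diagram n) :
    (ofDiagram X * ofDiagram Y : VTL K d n) = d ^ loops X Y • ofDiagram (comp X Y) := by
  simp [VTL.mul_eq_sum, coeff_ofDiagram, ite_smul]

theorem ofDiagram_permDiagram_mul (σ : Equiv.Perm (Fin n)) (D : Diagram n) :
    (ofDiagram (permDiagram σ) * ofDiagram D : VTL K d n) =
      ofDiagram ((Equiv.Perm.sumCongr σ (1 : Equiv.Perm (Fin n)))⁻¹ • D) := by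
  rw [ofDiagram_mul_ofDiagram, loops_permDiagram, comp_permDiagram, pow_zero, one_smul]

/-- The `K`-linear anti-automorphism given by reflection of the diagrams. -/
noncomputable instance : Star (VTL K d n) where
  star f := ∑ D, coeff f (flip D) • ofDiagram D

@[simp]
theorem coeff_star (f : VTL K d n) (D : Diagram n) : coeff (star f) D = coeff f (flip D) :=
  coeff_sum_smul_ofDiagram (fun D => coeff f (flip D)) D

theorem star_smul_eq (r : K) (f : VTL K d n) : star (r • f) = r • star f :=
  VTL.ext fun D => by simp

@[simp]
theorem star_ofDiagram (D : Diagram n) :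
    star (ofDiagram D : VTL K d n) = ofDiagram (flip D) := by
  refine VTL.ext fun E => ?_
  rw [coeff_star, coeff_ofDiagram, coeff_ofDiagram, ← flip_flip E, flip_flip]
  exact if_congr ⟨congrArg flip, fun h => by simpa using congrArg flip h⟩ rfl rfl

theorem VTL.mul_assoc (f g h : VTL K d n) : f * g * h = f * (g * h) := by
  induction f using VTL.induction_linear with
  | zero => simp only [zero_mul]
  | add f f' hf hf' => simp only [add_mul, hf, hf']
  | smul r X =>
  induction g using VTL.induction_linear with
  | zero => simp only [zero_mul, mul_zero]
  | add g g' hg hg' => simp only [add_mul, mul_add, hg, hg']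
  | smul s Y =>
  induction h using VTL.induction_linear with
  | zero => simp only [mul_zero]
  | add h h' hh hh' => simp only [mul_add, hh, hh']
  | smul t Z =>
  obtain ⟨hcomp, hloops⟩ := comp_assoc_and_loops_add X Y Z
  have hdiag : (ofDiagram X * ofDiagram Y * ofDiagram Z : VTL K d n) =
      ofDiagram X * (ofDiagram Y * ofDiagram Z) := by
    simp only [ofDiagram_mul_ofDiagram, smul_mul_assoc, mul_smul_comm, smul_smul, ← pow_add,
      hcomp, hloops]
  simp only [smul_mul_assoc, mul_smul_comm, hdiag]

theorem VTL.star_mul (f g : VTL K d n) : star (f * g) = star g * star f := by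
  have hadd : ∀ f g : VTL K d n, star (f + g) = star f + star g := fun f g =>
    VTL.ext fun D => by simp
  have hzero : star (0 : VTL K d n) = 0 := by simpa using star_smul_eq 0 (0 : VTL K d n)
  induction f using VTL.induction_linear with
  | zero => simp only [zero_mul, mul_zero, hzero]
  | add f f' hf hf' => simp only [add_mul, mul_add, hadd, hf, hf']
  | smul r X =>
  induction g using VTL.induction_linear with
  | zero => simp only [zero_mul, mul_zero, hzero]
  | add g g' hg hg' => simp only [add_mul, mul_add, hadd, hg, hg']
  | smul s Y =>
  obtain ⟨hcomp, hloops⟩ := flip_comp_and_loops_flip X Y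
  simp only [smul_mul_assoc, mul_smul_comm, star_smul_eq, ofDiagram_mul_ofDiagram, star_ofDiagram,
    hcomp, hloops]
  rw [smul_comm r s]

theorem VTL.one_mul (f : VTL K d n) : 1 * f = f := by
  induction f using VTL.induction_linear with
  | zero => rw [mul_zero]
  | add f f' hf hf' => rw [mul_add, hf, hf']
  | smul r X =>
    rw [mul_smul_comm]
    refine congrArg (r • ·) ((ofDiagram_permDiagram_mul 1 X).trans ?_)
    rw [Equiv.Perm.sumCongr_one, inv_one, one_smul]

noncomputable instance : Ring (VTL K d n) :=
  { (inferInstance : NonUnitalNonAssocRing (VTL K d n)), (inferInstance : One (VTL K d n)) with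
    mul_assoc := VTL.mul_assoc
    one_mul := VTL.one_mul
    mul_one := fun f => by
      have hinv : ∀ g : VTL K d n, star (star g) = g := fun g => VTL.ext fun D => by simp
      have hone : star (1 : VTL K d n) = 1 := by
        refine (star_ofDiagram (permDiagram 1)).trans ?_
        rw [flip_permDiagram, inv_one]
        rfl
      have h := congrArg star (VTL.one_mul (star f))
      rwa [VTL.star_mul, hone, hinv] at h }

noncomputable instance : StarRing (VTL K d n) where
  star_involutive f := VTL.ext fun D => by simp
  star_mul := VTL.star_mul
  star_add f g := VTL.ext fun D => by simp

theorem coeff_ofDiagram_mul (X : Diagram n) (f : VTL K d n) (E : Diagram n) :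
    coeff (ofDiagram X * f) E =
      ∑ D with comp X D = E, coeff f D * d ^ loops X D := by
  simp [VTL.mul_eq_sum, coeff_sum, coeff_ofDiagram, Finset.sum_filter]

theorem coeff_permDiagram_mul (σ : Equiv.Perm (Fin n)) (f : VTL K d n) (E : Diagram n) :
    coeff (ofDiagram (permDiagram σ) * f) E =
      coeff f (Equiv.Perm.sumCongr σ (1 : Equiv.Perm (Fin n)) • E) := by
  simp only [coeff_ofDiagram_mul, comp_permDiagram, loops_permDiagram, pow_zero, mul_one,
    inv_smul_eq_iff, Finset.filter_eq', Finset.mem_univ, if_true, Finset.sum_singleton]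

theorem comp_hookDiagram_mate {a b : Fin n} (hab : a ≠ b) (D : Diagram n) :
    (comp (hookDiagram a b hab) D).mate (Sum.inl a) = Sum.inl b := by
  rw [comp_hookDiagram, Diagram.smul_mate, Equiv.swap_inv,
    Equiv.swap_apply_of_ne_of_ne (by simpa using hab) (D.mate_ne _).symm, Equiv.swap_apply_right]

theorem coeff_hookDiagram_mul_of_ne {a b : Fin n} (hab : a ≠ b) (f : VTL K d n) {E : Diagram n}
    (hE : E.mate (Sum.inl a) ≠ Sum.inl b) : coeff (ofDiagram (hookDiagram a b hab) * f) E = 0 := by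
  rw [coeff_ofDiagram_mul, Finset.filter_false_of_mem, Finset.sum_empty]
  rintro D - rfl
  exact hE (comp_hookDiagram_mate hab D)

theorem swap_smul_mate {E : Diagram n} {p q x : Fin n ⊕ Fin n} (hE : E.mate p = q) (hx : x ≠ p) :
    (swap q x • E).mate p = x := by
  have hpq : p ≠ q := hE ▸ (E.mate_ne p).symm
  rw [Diagram.smul_mate, Equiv.swap_inv, Equiv.swap_apply_of_ne_of_ne hpq hx.symm, hE,
    Equiv.swap_apply_left]

theorem swap_smul_of_mate_eq {E : Diagram n} {p q : Fin n ⊕ Fin n} (hE : E.mate p = q) :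
    swap q p • E = E := by
  refine Diagram.ext (mul_inv_eq_iff_eq_mul.2 ?_)
  rw [Equiv.mul_swap_eq_swap_mul, hE, E.mate_eq_comm.1 hE, Equiv.swap_comm]

theorem coeff_hookDiagram_mul_eq_sum_ne {a b : Fin n} (hab : a ≠ b) (f : VTL K d n)
    {E : Diagram n} (hE : E.mate (Sum.inl a) = Sum.inl b) :
    coeff (ofDiagram (hookDiagram a b hab) * f) E =
      ∑ x : Fin n ⊕ Fin n with x ≠ Sum.inl a,
        coeff f (swap (Sum.inl b) x • E) * if x = Sum.inl b then d else 1 := by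
  have hcancel : ∀ (x : Fin n ⊕ Fin n) (D : Diagram n),
      swap (Sum.inl b) x • swap (Sum.inl b) x • D = D := fun x D => by
    rw [← mul_smul, Equiv.swap_mul_self, one_smul]
  rw [coeff_ofDiagram_mul]
  refine Finset.sum_nbij' (fun D => D.mate (Sum.inl a)) (fun x => swap (Sum.inl b) x • E)
    (fun D _ => by simpa using D.mate_ne _) (fun x hx => ?_) (fun D hD => ?_) (fun x hx => ?_)
    (fun D hD => ?_)
  · rw [Finset.mem_filter_univ] at hx ⊢
    rw [comp_hookDiagram, swap_smul_mate hE hx, hcancel]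
  · rw [← (Finset.mem_filter.1 hD).2, comp_hookDiagram, hcancel]
  · exact swap_smul_mate hE (Finset.mem_filter.1 hx).2
  · rw [← (Finset.mem_filter.1 hD).2, comp_hookDiagram, hcancel]
    split_ifs with h
    · rw [loops_hookDiagram_of_eq hab D h, pow_one]
    · rw [loops_hookDiagram_of_ne hab D h, pow_zero]

theorem coeff_hookDiagram_mul {a b : Fin n} (hab : a ≠ b) (f : VTL K d n) {E : Diagram n}
    (hE : E.mate (Sum.inl a) = Sum.inl b) :
    coeff (ofDiagram (hookDiagram a b hab) * f) E =
      ∑ x : Fin n ⊕ Fin n, coeff f (swap (Sum.inl b) x • E) + (d - 2) * coeff f E := by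
  have hsplit : ∀ x : Fin n ⊕ Fin n,
      coeff f (swap (Sum.inl b) x • E) * (if x = Sum.inl b then d else 1) =
        coeff f (swap (Sum.inl b) x • E) + if x = Sum.inl b then (d - 1) * coeff f E else 0 := by
    intro x
    split_ifs with h
    · rw [h, Equiv.swap_self, ← Equiv.Perm.one_def, one_smul]
      ring
    · ring
  rw [coeff_hookDiagram_mul_eq_sum_ne hab f hE, Finset.filter_ne',
    Finset.sum_congr rfl fun x _ => hsplit x, Finset.sum_add_distrib,
    Finset.sum_erase_eq_sub (Finset.mem_univ _), swap_smul_of_mate_eq hE, Finset.sum_ite_eq',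
    if_pos (by simpa using hab.symm)]
  ring

end Algebra

section Caps

/-- The top points that are joined to top points. -/
def Diagram.caps (D : Diagram n) : Finset (Fin n) :=
  {i | (D.mate (Sum.inl i)).isLeft}

theorem Diagram.mem_caps {D : Diagram n} {i : Fin n} :
    i ∈ D.caps ↔ (D.mate (Sum.inl i)).isLeft :=
  Finset.mem_filter_univ i

theorem Diagram.mem_caps_of_mate_eq {D : Diagram n} {i j : Fin n}
    (h : D.mate (Sum.inl i) = Sum.inl j) : i ∈ D.caps := by
  simp [mem_caps, h]

theorem Diagram.card_caps_add_through (D : Diagram n) : D.caps.card + D.through = n := by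
  have h := Finset.card_filter_add_card_filter_not (s := Finset.univ)
    fun i : Fin n => (D.mate (Sum.inl i)).isLeft = true
  simpa only [caps, through, Sum.not_isLeft, Finset.card_fin] using h

theorem Diagram.through_flip (D : Diagram n) : (flip D).through = D.through := by
  have hsum : ∑ x, (if x.isRight ∧ (D.mate x).isLeft then 1 else 0) =
      ∑ x, if x.isLeft ∧ (D.mate x).isRight then 1 else 0 := by
    rw [← Equiv.sum_comp D.mate]
    exact Finset.sum_congr rfl fun x _ => by simp only [D.mate_mate, and_comm]
  simpa only [through, flip_mate, Fintype.sum_sum_type, Finset.card_filter, Sum.swap_inl,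
    Sum.isRight_swap, Sum.isRight_inl, Sum.isRight_inr, Sum.isLeft_inl, Sum.isLeft_inr,
    Bool.false_eq_true, false_and, true_and, if_false, Finset.sum_const_zero, zero_add,
    add_zero] using hsum

theorem Diagram.card_caps_flip (D : Diagram n) : (flip D).caps.card = D.caps.card := by
  have h := (flip D).card_caps_add_through
  have h' := D.card_caps_add_through
  rw [D.through_flip] at h
  lia

theorem Diagram.exists_cap {D : Diagram n} (h : D.caps.Nonempty) :
    ∃ a b, D.mate (Sum.inl a) = Sum.inl b :=
  let ⟨a, ha⟩ := h
  ⟨a, Sum.isLeft_iff.1 (mem_caps.1 ha)⟩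

theorem Diagram.exists_cup {D : Diagram n} (h : D.caps.Nonempty) :
    ∃ a b, D.mate (Sum.inr a) = Sum.inr b := by
  rw [← Finset.card_pos, ← card_caps_flip, Finset.card_pos] at h
  simpa only [flip_mate_inl_eq_inl] using exists_cap h

theorem Diagram.pair_subset_caps {D : Diagram n} {a b : Fin n}
    (h : D.mate (Sum.inl a) = Sum.inl b) : {a, b} ⊆ D.caps :=
  Finset.insert_subset (mem_caps_of_mate_eq h)
    (Finset.singleton_subset_iff.2 (mem_caps_of_mate_eq (D.mate_eq_comm.1 h)))

theorem Diagram.card_pair_of_mate_eq {D : Diagram n} {a b : Fin n}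
    (h : D.mate (Sum.inl a) = Sum.inl b) : ({a, b} : Finset (Fin n)).card = 2 :=
  Finset.card_pair fun hab => D.mate_ne (Sum.inl a) (hab ▸ h)

theorem Diagram.two_le_card_caps {D : Diagram n} {a b : Fin n}
    (h : D.mate (Sum.inl a) = Sum.inl b) : 2 ≤ D.caps.card :=
  card_pair_of_mate_eq h ▸ Finset.card_le_card (pair_subset_caps h)

theorem Diagram.card_caps_sumCongr_smul (ρ τ : Equiv.Perm (Fin n)) (D : Diagram n) :
    (Equiv.Perm.sumCongr ρ τ • D).caps.card = D.caps.card := by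
  refine Finset.card_equiv ρ⁻¹ fun i => ?_
  rw [mem_caps, mem_caps, smul_mate]
  simp

theorem swap_smul_mate_of_ne {E : Diagram n} {p q x z : Fin n ⊕ Fin n} (hE : E.mate p = q)
    (hp : z ≠ p) (hq : z ≠ q) (hx : z ≠ x) (hy : z ≠ E.mate x) :
    (swap q x • E).mate z = E.mate z := by
  rw [Diagram.smul_mate, Equiv.swap_inv, Equiv.swap_apply_of_ne_of_ne hq hx,
    Equiv.swap_apply_of_ne_of_ne]
  · rintro rfl
    exact hp (E.mate.injective hE).symm
  · rintro rfl
    exact hy (E.mate_mate z).symm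

theorem swap_smul_mate_right {E : Diagram n} {p q x : Fin n ⊕ Fin n} (hE : E.mate p = q)
    (hx : x ≠ p) : (swap q x • E).mate q = E.mate x := by
  have hq : E.mate x ≠ q := fun h => hx (E.mate.injective (h.trans hE.symm))
  rw [Diagram.smul_mate, Equiv.swap_inv, Equiv.swap_apply_left,
    Equiv.swap_apply_of_ne_of_ne hq (E.mate_ne x)]

theorem swap_smul_comm_of_mate_eq {E : Diagram n} {p q : Fin n ⊕ Fin n} (hE : E.mate p = q)
    (x : Fin n ⊕ Fin n) : swap q x • E = swap p (E.mate x) • E := by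
  rcases eq_or_ne x p with rfl | hp
  · rw [hE, Equiv.swap_comm]
  rcases eq_or_ne x q with rfl | -
  · rw [← hE, E.mate_mate, Equiv.swap_self, Equiv.swap_self]
  have hcomm : swap q x * swap p (E.mate x) = swap p (E.mate x) * swap q x := by
    rw [Equiv.mul_swap_eq_swap_mul,
      Equiv.swap_apply_of_ne_of_ne (hE ▸ (E.mate_ne p).symm) hp.symm,
      Equiv.swap_apply_of_ne_of_ne (fun h => hp (E.mate.injective (h.trans hE.symm)))
        (E.mate_ne x)]
  have hconj : E.mate * swap p (E.mate x) = swap q x * E.mate := by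
    rw [Equiv.mul_swap_eq_swap_mul, hE, E.mate_mate]
  have hconj' : E.mate * swap q x = swap p (E.mate x) * E.mate := by
    rw [Equiv.mul_swap_eq_swap_mul, E.mate_eq_comm.1 hE]
  refine Diagram.ext ?_
  change swap q x * E.mate * (swap q x)⁻¹ = swap p (E.mate x) * E.mate * (swap p (E.mate x))⁻¹
  rw [Equiv.swap_inv, Equiv.swap_inv, mul_assoc, mul_assoc, hconj, hconj', ← mul_assoc, hcomm,
    mul_assoc]

theorem Diagram.card_caps_swap_inl_smul (E : Diagram n) (b j : Fin n) :
    ((swap (Sum.inl b) (Sum.inl j) : Equiv.Perm (Fin n ⊕ Fin n)) • E).caps.card = E.caps.card := by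
  rw [← E.card_caps_sumCongr_smul (swap b j) 1, Equiv.Perm.sumCongr_swap_one]

theorem Diagram.caps_swap_inr_smul {E : Diagram n} {a b j l : Fin n}
    (hE : E.mate (Sum.inl a) = Sum.inl b) (hj : E.mate (Sum.inr j) = Sum.inr l) :
    (swap (Sum.inl b) (Sum.inr j) • E).caps = E.caps \ {a, b} := by
  ext i
  rw [Finset.mem_sdiff, mem_caps, mem_caps]
  rcases eq_or_ne i a with rfl | ha
  · simp [swap_smul_mate hE]
  rcases eq_or_ne i b with rfl | hb
  · simp [swap_smul_mate_right hE, hj]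
  · rw [swap_smul_mate_of_ne hE (by simpa using ha) (by simpa using hb) Sum.inl_ne_inr
      (hj ▸ Sum.inl_ne_inr)]
    simp [ha, hb]

theorem Diagram.card_caps_swap_smul {E : Diagram n} {a b : Fin n}
    (hE : E.mate (Sum.inl a) = Sum.inl b) (x : Fin n ⊕ Fin n) :
    (swap (Sum.inl b) x • E).caps.card =
      if x.isRight ∧ (E.mate x).isRight then E.caps.card - 2 else E.caps.card := by
  rcases x with j | j
  · rw [card_caps_swap_inl_smul, if_neg (by simp)]
  rcases hj : E.mate (Sum.inr j) with l | l
  · rw [swap_smul_comm_of_mate_eq hE, hj, card_caps_swap_inl_smul, if_neg (by simp)]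
  · rw [caps_swap_inr_smul hE hj, Finset.card_sdiff_of_subset (pair_subset_caps hE),
      card_pair_of_mate_eq hE, if_pos (by simp)]

end Caps

section Support

/-- The horizontal position of an end point. -/
def strandIndex : Fin n ⊕ Fin n → Fin n :=
  Sum.elim id id

/-- The arcs outside the first `m` strands are vertical: `D` comes from a diagram on `m` strands. -/
def Diagram.VerticalFrom (m : ℕ) (D : Diagram n) : Prop :=
  ∀ x, m ≤ (strandIndex x : ℕ) → D.mate x = x.swap

instance (m : ℕ) : DecidablePred (Diagram.VerticalFrom (n := n) m) := fun _ =>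
  inferInstanceAs (Decidable (∀ _, _ → _))

/-- The copy of the symmetric group on the first `m` letters in the permutations of `Fin n`. -/
def strandPerms (n m : ℕ) : Subgroup (Equiv.Perm (Fin n)) :=
  fixingSubgroup (Equiv.Perm (Fin n)) {i : Fin n | m ≤ (i : ℕ)}

theorem strandIndex_swap (x : Fin n ⊕ Fin n) : strandIndex x.swap = strandIndex x := by
  cases x <;> rfl

theorem mem_strandPerms {m : ℕ} {σ : Equiv.Perm (Fin n)} :
    σ ∈ strandPerms n m ↔ ∀ i : Fin n, m ≤ (i : ℕ) → σ i = i :=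
  mem_fixingSubgroup_iff _

theorem strandPerms_mono {m m' : ℕ} (h : m ≤ m') : strandPerms n m ≤ strandPerms n m' :=
  fun _ hσ => mem_strandPerms.2 fun i hi => mem_strandPerms.1 hσ i (h.trans hi)

theorem swap_mem_strandPerms {m : ℕ} {a b : Fin n} (ha : (a : ℕ) < m) (hb : (b : ℕ) < m) :
    swap a b ∈ strandPerms n m :=
  mem_strandPerms.2 fun i hi => Equiv.swap_apply_of_ne_of_ne (by grind) (by grind)

theorem apply_lt_of_mem_strandPerms {m : ℕ} {σ : Equiv.Perm (Fin n)} (hσ : σ ∈ strandPerms n m)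
    {i : Fin n} (hi : (i : ℕ) < m) : (σ i : ℕ) < m := by
  by_contra! h
  have : σ i = i := σ.injective (mem_strandPerms.1 hσ _ h)
  lia

instance (m : ℕ) : DecidablePred (· ∈ strandPerms n m) := fun _ =>
  decidable_of_iff' _ mem_strandPerms

theorem card_strandPerms {m : ℕ} (hm : m ≤ n) :
    ({σ | σ ∈ strandPerms n m} : Finset (Equiv.Perm (Fin n))).card = m.factorial := by
  have e : {σ // σ ∈ strandPerms n m} ≃ Equiv.Perm {i : Fin n // (i : ℕ) < m} :=
    (Equiv.subtypeEquivRight fun σ => by simp [mem_strandPerms]).trans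
      (Equiv.Perm.subtypeEquivSubtypePerm fun i : Fin n => (i : ℕ) < m).symm
  rw [← Fintype.card_subtype, Fintype.card_congr e, Fintype.card_perm, Fintype.card_subtype,
    Fin.card_filter_val_lt, min_eq_right hm]

theorem Diagram.verticalFrom_permDiagram {m : ℕ} {σ : Equiv.Perm (Fin n)} :
    (permDiagram σ).VerticalFrom m ↔ σ ∈ strandPerms n m := by
  refine ⟨fun h => mem_strandPerms.2 fun i hi => Sum.inr_injective (h (Sum.inl i) hi), ?_⟩
  rintro h (i | i) hi
  · exact congrArg Sum.inr (mem_strandPerms.1 h i hi)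
  · exact congrArg Sum.inl (mem_strandPerms.1 (inv_mem h) i hi)

theorem Diagram.VerticalFrom.smul {m : ℕ} {D : Diagram n} (hD : D.VerticalFrom m)
    {π : Equiv.Perm (Fin n ⊕ Fin n)} (hπ : ∀ x, m ≤ (strandIndex x : ℕ) → π x = x) :
    (π • D).VerticalFrom m := fun x hx => by
  rw [smul_mate, Equiv.Perm.inv_eq_iff_eq.2 (hπ x hx).symm, hD x hx,
    hπ x.swap (by rwa [strandIndex_swap])]

theorem Diagram.verticalFrom_smul_iff {m : ℕ} {D : Diagram n} {π : Equiv.Perm (Fin n ⊕ Fin n)}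
    (hπ : ∀ x, m ≤ (strandIndex x : ℕ) → π x = x) :
    (π • D).VerticalFrom m ↔ D.VerticalFrom m := by
  refine ⟨fun h => ?_, fun h => h.smul hπ⟩
  have := h.smul (π := π⁻¹) fun x hx => Equiv.Perm.inv_eq_iff_eq.2 (hπ x hx).symm
  rwa [inv_smul_smul] at this

theorem sumCongr_apply_of_mem_strandPerms {m : ℕ} {ρ τ : Equiv.Perm (Fin n)}
    (hρ : ρ ∈ strandPerms n m) (hτ : τ ∈ strandPerms n m) (x : Fin n ⊕ Fin n)
    (hx : m ≤ (strandIndex x : ℕ)) : Equiv.Perm.sumCongr ρ τ x = x := by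
  rcases x with i | i
  · exact congrArg Sum.inl (mem_strandPerms.1 hρ i hx)
  · exact congrArg Sum.inr (mem_strandPerms.1 hτ i hx)

theorem swap_apply_of_strandIndex_lt {m : ℕ} {x y : Fin n ⊕ Fin n}
    (hx : (strandIndex x : ℕ) < m) (hy : (strandIndex y : ℕ) < m) (z : Fin n ⊕ Fin n)
    (hz : m ≤ (strandIndex z : ℕ)) : swap x y z = z :=
  Equiv.swap_apply_of_ne_of_ne (fun h => absurd (h ▸ hx) hz.not_gt)
    fun h => absurd (h ▸ hy) hz.not_gt

theorem Diagram.verticalFrom_flip {m : ℕ} {D : Diagram n} :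
    (flip D).VerticalFrom m ↔ D.VerticalFrom m := by
  have key : ∀ {E : Diagram n}, E.VerticalFrom m → (flip E).VerticalFrom m := fun {E} hE x hx => by
    rw [flip_mate, hE x.swap (by rwa [strandIndex_swap]), Sum.swap_swap]
  exact ⟨fun h => flip_flip D ▸ key h, key⟩

theorem Diagram.VerticalFrom.lt_of_mem_caps {m : ℕ} {D : Diagram n} (hD : D.VerticalFrom m)
    {i : Fin n} (hi : i ∈ D.caps) : (i : ℕ) < m := by
  by_contra! h
  simpa [hD (Sum.inl i) h] using mem_caps.1 hi

theorem Diagram.VerticalFrom.lt_of_mate_inr_eq_inr {m : ℕ} {D : Diagram n}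
    (hD : D.VerticalFrom m) {a b : Fin n} (h : D.mate (Sum.inr a) = Sum.inr b) : (a : ℕ) < m :=
  (verticalFrom_flip.2 hD).lt_of_mem_caps (mem_caps_of_mate_eq (flip_mate_inl_eq_inl.2 h))

theorem Diagram.VerticalFrom.card_caps_le {m : ℕ} {D : Diagram n} (hD : D.VerticalFrom m) :
    D.caps.card ≤ m := by
  simpa using Finset.card_le_card_of_injOn Fin.val (t := Finset.range m)
    (fun i hi => Finset.mem_coe.2 (Finset.mem_range.2 (hD.lt_of_mem_caps hi)))
    Fin.val_injective.injOn

theorem Diagram.verticalFrom_swap_smul_iff {m : ℕ} {E : Diagram n} {a b : Fin n}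
    (hE : E.mate (Sum.inl a) = Sum.inl b) (ha : (a : ℕ) < m) (hb : (b : ℕ) < m)
    (x : Fin n ⊕ Fin n) :
    (swap (Sum.inl b) x • E).VerticalFrom m ↔ E.VerticalFrom m ∧ (strandIndex x : ℕ) < m := by
  by_cases hx : (strandIndex x : ℕ) < m
  · rw [verticalFrom_smul_iff (swap_apply_of_strandIndex_lt (x := Sum.inl b) hb hx),
      and_iff_left hx]
  refine iff_of_false (fun h => ?_) fun h => hx h.2
  have hxa : x ≠ Sum.inl a := fun h => hx (h ▸ ha)
  have hmate := mate_eq_comm _ |>.1 (swap_smul_mate hE hxa)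
  rw [h x (not_lt.1 hx)] at hmate
  exact hx (by rwa [← strandIndex_swap, hmate])

end Support

section Weight

variable {K : Type*} [Field K]

/-- The coefficient in the projector `f_m` of a diagram with `b` caps. The two-step recursion says
that `f_m` is killed by hooks. -/
def weight (d : K) (m : ℕ) : ℕ → K
  | 0 => (m.factorial : K)⁻¹
  | 1 => 0
  | b + 2 => -((b : K) + 2) / (d + 2 * (m : K) - 4 - b) * weight d m b

theorem weight_recursion {d : K} {m b : ℕ} (hd : ∀ j : ℕ, j + 2 ≤ m → d ≠ -(2 * (j : K)))
    (hb : b + 2 ≤ m) :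
    (d + 2 * (m : K) - 4 - b) * weight d m (b + 2) + ((b : K) + 2) * weight d m b = 0 := by
  rcases Nat.even_or_odd' b with ⟨j, rfl | rfl⟩
  · have hden : d + 2 * (m : K) - 4 - (2 * j : ℕ) ≠ 0 := fun h => by
      refine hd (m - (j + 2)) (by lia) ?_
      push_cast [show j + 2 ≤ m by lia] at h ⊢
      linear_combination h
    rw [weight, div_mul_eq_mul_div, mul_div_cancel₀ _ hden]
    ring
  · have hodd : ∀ i, weight d m (2 * i + 1) = 0 := fun i => by
      induction i with
      | zero => rfl
      | succ i ih => rw [Nat.mul_succ, Nat.add_right_comm, weight, ih, mul_zero]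
    rw [hodd, show 2 * j + 1 + 2 = 2 * (j + 1) + 1 by ring, hodd, mul_zero, mul_zero, add_zero]

theorem weight_succ_two_mul_succ (d : K) (m j : ℕ) :
    weight d (m + 1) (2 * (j + 1)) =
      ((j + 1 : ℕ) : K) * (-2 / (((m + 1 : ℕ) : K) * (d + 2 * ((m + 1 : ℕ) : K) - 4))) *
        weight d m (2 * j) := by
  induction j with
  | zero =>
    simp only [Nat.zero_add, weight, Nat.factorial_succ]
    push_cast
    rw [mul_inv, div_eq_mul_inv, div_eq_mul_inv, mul_inv]
    ring
  | succ j ih =>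
    rw [Nat.mul_succ 2 (j + 1), weight, ih, Nat.mul_succ 2 j, weight]
    push_cast
    rw [show d + 2 * ((m : K) + 1) - 4 - (2 * (j : K) + 2) = d + 2 * (m : K) - 4 - 2 * (j : K) by
      ring]
    ring

end Weight

section SymmetricProjector

variable {K : Type*} [Field K] {d : K}

/-- The coefficients of `symProj`. -/
def symCoeff (d : K) (m : ℕ) (D : Diagram n) : K :=
  if D.VerticalFrom m then weight d m D.caps.card else 0

/-- The projector `f_m` inside `VTL_n(d)` in closed form: the coefficient of a diagram on the first
`m` strands depends on its number of caps only. -/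
noncomputable def symProj (d : K) (n m : ℕ) : VTL K d n :=
  ∑ D : Diagram n, symCoeff d m D • ofDiagram D

@[simp]
theorem coeff_symProj (m : ℕ) (D : Diagram n) : coeff (symProj d n m) D = symCoeff d m D :=
  coeff_sum_smul_ofDiagram _ _

theorem star_symProj (m : ℕ) : star (symProj d n m) = symProj d n m := by
  refine VTL.ext fun D => ?_
  rw [coeff_star, coeff_symProj, coeff_symProj, symCoeff, symCoeff, Diagram.card_caps_flip]
  exact if_congr Diagram.verticalFrom_flip rfl rfl

theorem symCoeff_sumCongr_smul {m : ℕ} {ρ τ : Equiv.Perm (Fin n)} (hρ : ρ ∈ strandPerms n m)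
    (hτ : τ ∈ strandPerms n m) (D : Diagram n) :
    symCoeff d m (Equiv.Perm.sumCongr ρ τ • D) = symCoeff d m D := by
  rw [symCoeff, symCoeff, Diagram.card_caps_sumCongr_smul]
  exact if_congr (Diagram.verticalFrom_smul_iff (sumCongr_apply_of_mem_strandPerms hρ hτ)) rfl rfl

theorem caps_permDiagram (σ : Equiv.Perm (Fin n)) : (permDiagram σ).caps = ∅ :=
  Finset.filter_eq_empty_iff.2 fun i _ => by simp

theorem symCoeff_permDiagram {m : ℕ} {σ : Equiv.Perm (Fin n)} (hσ : σ ∈ strandPerms n m) :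
    symCoeff d m (permDiagram σ) = (m.factorial : K)⁻¹ := by
  rw [symCoeff, if_pos (Diagram.verticalFrom_permDiagram.2 hσ), caps_permDiagram,
    Finset.card_empty, weight]

theorem permDiagram_mul_symProj {m : ℕ} {σ : Equiv.Perm (Fin n)} (hσ : σ ∈ strandPerms n m) :
    ofDiagram (permDiagram σ) * symProj d n m = symProj d n m := by
  refine VTL.ext fun D => ?_
  rw [coeff_permDiagram_mul, coeff_symProj, coeff_symProj,
    symCoeff_sumCongr_smul hσ (one_mem _)]

theorem symProj_mul_permDiagram {m : ℕ} {σ : Equiv.Perm (Fin n)} (hσ : σ ∈ strandPerms n m) :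
    symProj d n m * ofDiagram (permDiagram σ) = symProj d n m := by
  have h := congrArg star (permDiagram_mul_symProj (d := d) (inv_mem hσ))
  rwa [star_mul, star_symProj, star_ofDiagram, flip_permDiagram, inv_inv] at h

theorem symCoeff_swap_smul {m : ℕ} {E : Diagram n} {a b : Fin n} (hv : E.VerticalFrom m)
    (hE : E.mate (Sum.inl a) = Sum.inl b) (ha : (a : ℕ) < m) (hb : (b : ℕ) < m)
    (x : Fin n ⊕ Fin n) :
    symCoeff d m (swap (Sum.inl b) x • E) =
      (if (strandIndex x : ℕ) < m then weight d m E.caps.card else 0) +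
        if x.isRight ∧ (E.mate x).isRight then
          weight d m (E.caps.card - 2) - weight d m E.caps.card else 0 := by
  rw [symCoeff, Diagram.card_caps_swap_smul hE,
    if_congr ((Diagram.verticalFrom_swap_smul_iff hE ha hb x).trans (and_iff_right hv)) rfl rfl]
  by_cases hx : (strandIndex x : ℕ) < m
  · split_ifs <;> ring
  · have : ¬ (x.isRight ∧ (E.mate x).isRight) := by
      rw [hv x (not_lt.1 hx)]
      cases x <;> simp
    rw [if_neg hx, if_neg hx, if_neg this, add_zero]

theorem sum_strandIndex_lt {m : ℕ} (hm : m ≤ n) (c : K) :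
    ∑ x : Fin n ⊕ Fin n, (if (strandIndex x : ℕ) < m then c else 0) = 2 * m * c := by
  have h : ∑ i : Fin n, (if (i : ℕ) < m then c else 0) = m * c := by
    rw [← Finset.sum_filter, Finset.sum_const, Fin.card_filter_val_lt, min_eq_right hm,
      nsmul_eq_mul]
  rw [Fintype.sum_sum_type, mul_assoc, two_mul]
  exact congrArg₂ _ h h

theorem sum_cups (D : Diagram n) (c : K) :
    ∑ x : Fin n ⊕ Fin n, (if x.isRight ∧ (D.mate x).isRight then c else 0) =
      D.caps.card * c := by
  rw [Fintype.sum_sum_type, ← D.card_caps_flip, Diagram.caps]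
  simp [← Finset.sum_filter, flip_mate]

theorem sum_symCoeff_swap_smul {m : ℕ} (hd : ∀ j : ℕ, j + 2 ≤ m → d ≠ -(2 * (j : K)))
    (hm : m ≤ n) {E : Diagram n} {a b : Fin n} (hE : E.mate (Sum.inl a) = Sum.inl b)
    (ha : (a : ℕ) < m) (hb : (b : ℕ) < m) :
    ∑ x : Fin n ⊕ Fin n, symCoeff d m (swap (Sum.inl b) x • E) + (d - 2) * symCoeff d m E = 0 := by
  by_cases hv : E.VerticalFrom m
  · rw [Finset.sum_congr rfl fun x _ => symCoeff_swap_smul hv hE ha hb x, Finset.sum_add_distrib,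
      sum_strandIndex_lt hm, sum_cups, symCoeff, if_pos hv]
    obtain ⟨T, hT⟩ := Nat.exists_eq_add_of_le' (Diagram.two_le_card_caps hE)
    have hrec := weight_recursion hd (hT ▸ hv.card_caps_le)
    rw [hT, Nat.add_sub_cancel]
    push_cast
    linear_combination hrec
  · have hzero : ∀ x, symCoeff d m (swap (Sum.inl b) x • E) = 0 := fun x =>
      if_neg fun h => hv ((Diagram.verticalFrom_swap_smul_iff hE ha hb x).1 h).1
    rw [Finset.sum_eq_zero fun x _ => hzero x, symCoeff, if_neg hv, mul_zero, add_zero]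

theorem hookDiagram_mul_symProj {m : ℕ} (hd : ∀ j : ℕ, j + 2 ≤ m → d ≠ -(2 * (j : K)))
    (hm : m ≤ n) {a b : Fin n} (hab : a ≠ b) (ha : (a : ℕ) < m) (hb : (b : ℕ) < m) :
    ofDiagram (hookDiagram a b hab) * symProj d n m = 0 := by
  refine VTL.ext fun E => ?_
  by_cases hE : E.mate (Sum.inl a) = Sum.inl b
  · simp only [coeff_hookDiagram_mul hab _ hE, coeff_symProj]
    exact sum_symCoeff_swap_smul hd hm hE ha hb
  · exact coeff_hookDiagram_mul_of_ne hab _ hE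

theorem hookDiagram_mul_of_mate_eq {a b : Fin n} (hab : a ≠ b) {D : Diagram n}
    (h : D.mate (Sum.inl a) = Sum.inl b) :
    (ofDiagram (hookDiagram a b hab) * ofDiagram D : VTL K d n) = d • ofDiagram D := by
  rw [ofDiagram_mul_ofDiagram, loops_hookDiagram_of_eq hab D h, pow_one, comp_hookDiagram, h,
    Equiv.swap_self]
  rfl

theorem symProj_mul_of_cap {m : ℕ} (hd : ∀ j : ℕ, j + 2 ≤ m → d ≠ -(2 * (j : K))) (hm : m ≤ n)
    {D : Diagram n} {a b : Fin n} (h : D.mate (Sum.inl a) = Sum.inl b)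
    (ha : (a : ℕ) < m) (hb : (b : ℕ) < m) : symProj d n m * ofDiagram D = 0 := by
  have hab : a ≠ b := fun hab => D.mate_ne (Sum.inl a) (hab ▸ h)
  have hd0 : d ≠ 0 := by simpa using hd 0 (by grind)
  have hhook := congrArg star (hookDiagram_mul_symProj hd hm hab ha hb)
  rw [star_mul, star_symProj, star_ofDiagram, flip_hookDiagram, star_zero] at hhook
  refine (smul_eq_zero.1 ?_).resolve_left hd0
  rw [← mul_smul_comm, ← hookDiagram_mul_of_mate_eq hab h, ← mul_assoc, hhook, zero_mul]

theorem mul_symProj_of_cup {m : ℕ} (hd : ∀ j : ℕ, j + 2 ≤ m → d ≠ -(2 * (j : K))) (hm : m ≤ n)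
    {D : Diagram n} {a b : Fin n} (h : D.mate (Sum.inr a) = Sum.inr b)
    (ha : (a : ℕ) < m) (hb : (b : ℕ) < m) : ofDiagram D * symProj d n m = 0 := by
  have := congrArg star (symProj_mul_of_cap hd hm (flip_mate_inl_eq_inl.2 h) ha hb)
  rwa [star_mul, star_symProj, star_ofDiagram, flip_flip, star_zero] at this

end SymmetricProjector

section PermutationPart

variable {K : Type*} [Field K] {d : K}

theorem exists_permDiagram_of_caps_eq_empty {D : Diagram n} (hD : D.caps = ∅) :
    ∃ σ, permDiagram σ = D := by
  have hright : ∀ i, ∃ j, D.mate (Sum.inl i) = Sum.inr j := fun i => by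
    have hi : i ∉ D.caps := hD ▸ Finset.notMem_empty i
    rwa [Diagram.mem_caps, Sum.not_isLeft, Sum.isRight_iff] at hi
  choose σ hσ using hright
  have hinj : Function.Injective σ := fun i j h => Sum.inl_injective <|
    D.mate.injective <| by rw [hσ, hσ, h]
  refine ⟨Equiv.ofBijective σ (Finite.injective_iff_bijective.1 hinj), Diagram.ext_mate ?_⟩
  rintro (i | j)
  · exact (hσ i).symm
  · obtain ⟨i, rfl⟩ := (Finite.injective_iff_surjective.1 hinj) j
    rw [D.mate_eq_comm.1 (hσ i)]
    exact congrArg Sum.inl (Equiv.ofBijective_symm_apply_apply σ _ i)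

theorem sum_eq_sum_permDiagram {M : Type*} [AddCommMonoid M] {m : ℕ} {g : Diagram n → M}
    (hg : ∀ D, g D ≠ 0 → D.VerticalFrom m ∧ D.caps = ∅) :
    ∑ D, g D = ∑ σ with σ ∈ strandPerms n m, g (permDiagram σ) := by
  refine (Finset.sum_of_injOn permDiagram permDiagram_injective.injOn (by simp) (fun D _ hD => ?_)
    fun _ _ => rfl).symm
  by_contra hne
  obtain ⟨hv, hcaps⟩ := hg D hne
  obtain ⟨σ, rfl⟩ := exists_permDiagram_of_caps_eq_empty hcaps
  exact hD ⟨σ, by simpa using Diagram.verticalFrom_permDiagram.1 hv, rfl⟩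

theorem symProj_mul_symProj {m m' : ℕ} (hd : ∀ j : ℕ, j + 2 ≤ m' → d ≠ -(2 * (j : K)))
    (hfac : (m.factorial : K) ≠ 0) (hmm : m ≤ m') (hm : m' ≤ n) :
    symProj d n m * symProj d n m' = symProj d n m' := by
  rw [symProj, Finset.sum_mul, sum_eq_sum_permDiagram (m := m)]
  · have hterm : ∀ σ ∈ ({σ | σ ∈ strandPerms n m} : Finset (Equiv.Perm (Fin n))),
        symCoeff d m (permDiagram σ) • ofDiagram (permDiagram σ) * symProj d n m' =
          (m.factorial : K)⁻¹ • symProj d n m' := fun σ hσ => by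
      rw [Finset.mem_filter_univ] at hσ
      rw [symCoeff_permDiagram hσ, smul_mul_assoc,
        permDiagram_mul_symProj (strandPerms_mono hmm hσ)]
    rw [Finset.sum_congr rfl hterm, Finset.sum_const, card_strandPerms (hmm.trans hm),
      ← Nat.cast_smul_eq_nsmul K, smul_inv_smul₀ hfac]
  · intro D hD
    have hv : D.VerticalFrom m := by
      by_contra hv
      simp [symCoeff, hv] at hD
    refine ⟨hv, Finset.not_nonempty_iff_eq_empty.1 fun hcaps => hD ?_⟩
    obtain ⟨a, b, hab⟩ := Diagram.exists_cup hcaps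
    rw [smul_mul_assoc, mul_symProj_of_cup hd hm hab
      ((hv.lt_of_mate_inr_eq_inr hab).trans_le hmm)
      ((hv.lt_of_mate_inr_eq_inr (D.mate_eq_comm.1 hab)).trans_le hmm), smul_zero]

theorem symProj_mul_symProj_of_le {m m' : ℕ} (hd : ∀ j : ℕ, j + 2 ≤ m' → d ≠ -(2 * (j : K)))
    (hfac : (m.factorial : K) ≠ 0) (hmm : m ≤ m') (hm : m' ≤ n) :
    symProj d n m' * symProj d n m = symProj d n m' := by
  have h := congrArg star (symProj_mul_symProj hd hfac hmm hm)
  rwa [star_mul, star_symProj, star_symProj] at h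

end PermutationPart

section Sandwich

variable {K : Type*} [Field K] {d : K}

/-- Some arc joins two of the first `m` points of the same row. -/
def Diagram.HasTurnback (m : ℕ) (D : Diagram n) : Prop :=
  ∃ a b : Fin n, (a : ℕ) < m ∧ (b : ℕ) < m ∧
    (D.mate (Sum.inl a) = Sum.inl b ∨ D.mate (Sum.inr a) = Sum.inr b)

theorem symProj_sandwich_of_hasTurnback {m : ℕ} (hd : ∀ j : ℕ, j + 2 ≤ m → d ≠ -(2 * (j : K)))
    (hm : m ≤ n) {D : Diagram n} (hD : D.HasTurnback m) :
    symProj d n m * ofDiagram D * symProj d n m = 0 := by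
  obtain ⟨a, b, ha, hb, h | h⟩ := hD
  · rw [symProj_mul_of_cap hd hm h ha hb, zero_mul]
  · rw [mul_assoc, mul_symProj_of_cup hd hm h ha hb, mul_zero]

theorem flip_sumCongr_smul (ρ τ : Equiv.Perm (Fin n)) (D : Diagram n) :
    flip (Equiv.Perm.sumCongr ρ τ • D) = Equiv.Perm.sumCongr τ ρ • flip D := by
  have hcomm : (Equiv.sumComm (Fin n) (Fin n) : Equiv.Perm (Fin n ⊕ Fin n)) *
      Equiv.Perm.sumCongr ρ τ = Equiv.Perm.sumCongr τ ρ * Equiv.sumComm (Fin n) (Fin n) :=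
    Equiv.ext <| by rintro (i | i) <;> rfl
  rw [flip, flip, ← mul_smul, ← mul_smul, hcomm]

theorem symProj_mul_sumCongr_smul {m : ℕ} {ρ : Equiv.Perm (Fin n)} (hρ : ρ ∈ strandPerms n m)
    (D : Diagram n) :
    symProj d n m * ofDiagram (Equiv.Perm.sumCongr ρ (1 : Equiv.Perm (Fin n)) • D) =
      symProj d n m * ofDiagram D := by
  have h : ofDiagram (permDiagram ρ⁻¹) * ofDiagram D =
      (ofDiagram (Equiv.Perm.sumCongr ρ (1 : Equiv.Perm (Fin n)) • D) : VTL K d n) := by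
    rw [ofDiagram_permDiagram_mul, Equiv.Perm.sumCongr_inv, inv_inv, inv_one]
  rw [← h, ← mul_assoc, symProj_mul_permDiagram (inv_mem hρ)]

theorem sumCongr_smul_mul_symProj {m : ℕ} {τ : Equiv.Perm (Fin n)} (hτ : τ ∈ strandPerms n m)
    (D : Diagram n) :
    ofDiagram (Equiv.Perm.sumCongr (1 : Equiv.Perm (Fin n)) τ • D) * symProj d n m =
      ofDiagram D * symProj d n m := by
  have h := congrArg star (symProj_mul_sumCongr_smul (d := d) hτ (flip D))
  simpa only [star_mul, star_symProj, star_ofDiagram, flip_sumCongr_smul, flip_flip] using h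

theorem symProj_sandwich_sumCongr_smul {m : ℕ} {ρ τ : Equiv.Perm (Fin n)}
    (hρ : ρ ∈ strandPerms n m) (hτ : τ ∈ strandPerms n m) (D : Diagram n) :
    symProj d n m * ofDiagram (Equiv.Perm.sumCongr ρ τ • D) * symProj d n m =
      symProj d n m * ofDiagram D * symProj d n m := by
  have h : Equiv.Perm.sumCongr ρ τ =
      Equiv.Perm.sumCongr ρ (1 : Equiv.Perm (Fin n)) * Equiv.Perm.sumCongr 1 τ := by
    rw [Equiv.Perm.sumCongr_mul, mul_one, one_mul]
  rw [h, mul_smul, symProj_mul_sumCongr_smul hρ, mul_assoc, sumCongr_smul_mul_symProj hτ,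
    ← mul_assoc]

/-- The exchange of the two end points in column `l`; it acts on diagrams as the partial transpose
of the strand `l`. -/
def partialTranspose (l : Fin n) : Equiv.Perm (Fin n ⊕ Fin n) :=
  swap (Sum.inl l) (Sum.inr l)

theorem partialTranspose_mul_self (l : Fin n) : partialTranspose l * partialTranspose l = 1 :=
  Equiv.swap_mul_self _ _

theorem partialTranspose_smul_smul (l : Fin n) (D : Diagram n) :
    partialTranspose l • partialTranspose l • D = D := by
  rw [← mul_smul, partialTranspose_mul_self, one_smul]

theorem partialTranspose_inl_of_ne {l i : Fin n} (h : i ≠ l) :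
    partialTranspose l (Sum.inl i) = Sum.inl i :=
  Equiv.swap_apply_of_ne_of_ne (by simpa using h) Sum.inl_ne_inr

theorem partialTranspose_smul_verticalFrom_iff {l : Fin n} {D : Diagram n} :
    (partialTranspose l • D).VerticalFrom (l + 1) ↔ D.VerticalFrom (l + 1) :=
  Diagram.verticalFrom_smul_iff
    (swap_apply_of_strandIndex_lt (x := Sum.inl l) (Nat.lt_succ_self l) (Nat.lt_succ_self l))

theorem partialTranspose_smul_permDiagram_of_apply_eq {l : Fin n} {σ : Equiv.Perm (Fin n)}
    (h : σ l = l) : partialTranspose l • permDiagram σ = permDiagram σ :=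
  swap_smul_of_mate_eq ((permDiagram σ).mate_eq_comm.1 (by simp [h]))

theorem partialTranspose_smul_permDiagram_swap {p l : Fin n} (h : p ≠ l) :
    partialTranspose l • permDiagram (swap p l) = hookDiagram p l h := by
  refine Diagram.ext_mate ?_
  rintro (i | i) <;>
    rw [Diagram.smul_mate, partialTranspose, Equiv.swap_inv, hookDiagram_mate, hookMate] <;>
    rcases eq_or_ne i p with rfl | hp <;> rcases eq_or_ne i l with rfl | hl <;>
    simp_all [Equiv.swap_apply_def]

theorem partialTranspose_smul_sumCongr_smul {l : Fin n} {ρ τ : Equiv.Perm (Fin n)}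
    (hρ : ρ l = l) (hτ : τ l = l) (D : Diagram n) :
    partialTranspose l • Equiv.Perm.sumCongr ρ τ • D =
      Equiv.Perm.sumCongr ρ τ • partialTranspose l • D := by
  rw [← mul_smul, ← mul_smul, partialTranspose, Equiv.mul_swap_eq_swap_mul]
  simp [hρ, hτ]

theorem Diagram.VerticalFrom.lt_or_exists_cap {l a b : Fin n} {D : Diagram n}
    (hv : D.VerticalFrom (l + 1)) (h : D.mate (Sum.inl a) = Sum.inl b) :
    ((a : ℕ) < l ∧ (b : ℕ) < l) ∨ ∃ c, D.mate (Sum.inl l) = Sum.inl c := by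
  have h' := D.mate_eq_comm.1 h
  rcases eq_or_ne a l with rfl | ha
  · exact Or.inr ⟨b, h⟩
  rcases eq_or_ne b l with rfl | hb
  · exact Or.inr ⟨a, h'⟩
  have ha' := hv.lt_of_mem_caps (mem_caps_of_mate_eq h)
  have hb' := hv.lt_of_mem_caps (mem_caps_of_mate_eq h')
  exact Or.inl ⟨by grind, by grind⟩

theorem Diagram.VerticalFrom.lt_or_exists_cup {l a b : Fin n} {D : Diagram n}
    (hv : D.VerticalFrom (l + 1)) (h : D.mate (Sum.inr a) = Sum.inr b) :
    ((a : ℕ) < l ∧ (b : ℕ) < l) ∨ ∃ c, D.mate (Sum.inr l) = Sum.inr c := by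
  simpa only [flip_mate_inl_eq_inl] using
    (verticalFrom_flip.2 hv).lt_or_exists_cap (flip_mate_inl_eq_inl.2 h)

theorem Diagram.VerticalFrom.hasTurnback {l : Fin n} {D : Diagram n}
    (hv : D.VerticalFrom (l + 1)) (hD : D.caps.Nonempty)
    (ht : (partialTranspose l • D).caps.Nonempty) : D.HasTurnback l := by
  obtain ⟨a, b, hab⟩ := exists_cap hD
  rcases hv.lt_or_exists_cap hab with ⟨ha, hb⟩ | ⟨c, hc⟩
  · exact ⟨a, b, ha, hb, Or.inl hab⟩
  obtain ⟨a, b, hab⟩ := exists_cup hD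
  rcases hv.lt_or_exists_cup hab with ⟨ha, hb⟩ | ⟨c', hc'⟩
  · exact ⟨a, b, ha, hb, Or.inr hab⟩
  -- Now the partial transpose turns both arcs ending in column `l` into through strands.
  have hl : (partialTranspose l • D).mate (Sum.inl l) = Sum.inr c' := by
    have hc'l : (Sum.inr c' : Fin n ⊕ Fin n) ≠ Sum.inr l := hc' ▸ D.mate_ne _
    rw [smul_mate, partialTranspose, Equiv.swap_inv, Equiv.swap_apply_left, hc',
      Equiv.swap_apply_of_ne_of_ne Sum.inr_ne_inl hc'l]
  obtain ⟨a, b, hab⟩ := exists_cap ht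
  have ne_l : ∀ {i j}, (partialTranspose l • D).mate (Sum.inl i) = Sum.inl j → i ≠ l := by
    rintro _ j h rfl
    exact Sum.inr_ne_inl (hl.symm.trans h)
  have ha := ne_l hab
  have hb := ne_l (mate_eq_comm _ |>.1 hab)
  rw [← partialTranspose_inl_of_ne ha, ← partialTranspose_inl_of_ne hb, smul_mate_eq_iff] at hab
  have ha' := hv.lt_of_mem_caps (mem_caps_of_mate_eq hab)
  have hb' := hv.lt_of_mem_caps (mem_caps_of_mate_eq (D.mate_eq_comm.1 hab))
  exact ⟨a, b, by grind, by grind, Or.inl hab⟩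

theorem exists_sumCongr_smul_permDiagram_swap {p l : Fin n} (hp : (p : ℕ) < l)
    {σ : Equiv.Perm (Fin n)} (hσ : σ ∈ strandPerms n (l + 1)) (hσl : σ l ≠ l) :
    ∃ ρ ∈ strandPerms n l, ∃ τ ∈ strandPerms n l,
      permDiagram σ = Equiv.Perm.sumCongr ρ τ • permDiagram (swap p l) := by
  have hlt : (σ l : ℕ) < l := by
    have := apply_lt_of_mem_strandPerms hσ (Nat.lt_succ_self l)
    grind
  have hτ := swap_mem_strandPerms hp hlt
  set τ := swap p (σ l)
  refine ⟨(swap p l * τ * σ)⁻¹, inv_mem (mem_strandPerms.2 fun i hi => ?_), τ, hτ, ?_⟩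
  · rcases eq_or_ne i l with rfl | hil
    · simp [τ]
    have hli : (l : ℕ) < i := lt_of_le_of_ne hi fun h => hil (Fin.ext h).symm
    rw [Equiv.Perm.mul_apply, mem_strandPerms.1 hσ i hli, Equiv.Perm.mul_apply,
      mem_strandPerms.1 hτ i hi, Equiv.swap_apply_of_ne_of_ne (by grind) hil]
  · rw [sumCongr_smul_permDiagram]
    simp [τ, ← mul_assoc]

theorem caps_hookDiagram {a b : Fin n} (hab : a ≠ b) : (hookDiagram a b hab).caps = {a, b} := by
  ext i
  rw [Diagram.mem_caps, hookDiagram_mate, hookMate]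
  split_ifs <;> simp_all

theorem symProj_sandwich_permDiagram {p l : Fin n} (hp : (p : ℕ) < l)
    {σ : Equiv.Perm (Fin n)} (hσ : σ ∈ strandPerms n (l + 1)) (hσl : σ l ≠ l) :
    symProj d n l * ofDiagram (permDiagram σ) * symProj d n l =
      symProj d n l * ofDiagram (permDiagram (swap p l)) * symProj d n l := by
  obtain ⟨ρ, hρ, τ, hτ, h⟩ := exists_sumCongr_smul_permDiagram_swap hp hσ hσl
  rw [h, symProj_sandwich_sumCongr_smul hρ hτ]

theorem exists_partialTranspose_smul_permDiagram {p l : Fin n} (hp : (p : ℕ) < l) (hpl : p ≠ l)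
    {σ : Equiv.Perm (Fin n)} (hσ : σ ∈ strandPerms n (l + 1)) (hσl : σ l ≠ l) :
    ∃ ρ ∈ strandPerms n l, ∃ τ ∈ strandPerms n l,
      partialTranspose l • permDiagram σ = Equiv.Perm.sumCongr ρ τ • hookDiagram p l hpl := by
  obtain ⟨ρ, hρ, τ, hτ, h⟩ := exists_sumCongr_smul_permDiagram_swap hp hσ hσl
  refine ⟨ρ, hρ, τ, hτ, ?_⟩
  rw [h, partialTranspose_smul_sumCongr_smul (mem_strandPerms.1 hρ l le_rfl)
    (mem_strandPerms.1 hτ l le_rfl), partialTranspose_smul_permDiagram_swap hpl]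

/-- The diagrams with caps are reached from permutations by the partial transpose: those that have
caps both before and after it have a turnback. -/
theorem sum_eq_sum_permDiagram_add_partialTranspose {M : Type*} [AddCommMonoid M] {l : Fin n}
    {g : Diagram n → M} (hv : ∀ D, g D ≠ 0 → D.VerticalFrom (l + 1))
    (hturn : ∀ D, D.HasTurnback l → g D = 0) :
    ∑ D, g D = ∑ σ with σ ∈ strandPerms n (l + 1), (g (permDiagram σ) +
      if (partialTranspose l • permDiagram σ).caps.Nonempty then
        g (partialTranspose l • permDiagram σ) else 0) := by
  have hperm : ∑ D with ¬ D.caps.Nonempty, g D =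
      ∑ σ with σ ∈ strandPerms n (l + 1), g (permDiagram σ) := by
    rw [Finset.sum_filter, sum_eq_sum_permDiagram (m := l + 1)]
    · simp only [caps_permDiagram, Finset.not_nonempty_empty, not_false_eq_true, if_true]
    · intro D hD
      rw [ne_eq, ite_eq_right_iff, Classical.not_imp, Finset.not_nonempty_iff_eq_empty] at hD
      exact ⟨hv D hD.2, hD.1⟩
  have hhook : ∑ D with D.caps.Nonempty, g D =
      ∑ σ with σ ∈ strandPerms n (l + 1),
        if (partialTranspose l • permDiagram σ).caps.Nonempty then
          g (partialTranspose l • permDiagram σ) else 0 := by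
    rw [Finset.sum_filter, ← Equiv.sum_comp (MulAction.toPerm (partialTranspose l))]
    refine sum_eq_sum_permDiagram fun D hD => ?_
    rw [MulAction.toPerm_apply, ne_eq, ite_eq_right_iff, Classical.not_imp] at hD
    obtain ⟨hcaps, hne⟩ := hD
    have hvt := hv _ hne
    refine ⟨partialTranspose_smul_verticalFrom_iff.1 hvt,
      Finset.not_nonempty_iff_eq_empty.1 fun hcaps' => hne (hturn _ ?_)⟩
    exact hvt.hasTurnback hcaps (by rwa [partialTranspose_smul_smul])
  rw [← Finset.sum_filter_add_sum_filter_not _ fun D => D.caps.Nonempty, hperm, hhook,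
    Finset.sum_add_distrib, add_comm]

theorem card_caps_partialTranspose_smul_permDiagram {p l : Fin n} (hp : (p : ℕ) < l)
    {σ : Equiv.Perm (Fin n)} (hσ : σ ∈ strandPerms n (l + 1)) (hσl : σ l ≠ l) :
    (partialTranspose l • permDiagram σ).caps.card = 2 := by
  have hpl : p ≠ l := fun h => hp.ne (congrArg Fin.val h)
  obtain ⟨ρ, -, τ, -, h⟩ := exists_partialTranspose_smul_permDiagram hp hpl hσ hσl
  rw [h, Diagram.card_caps_sumCongr_smul, caps_hookDiagram, Finset.card_pair hpl]

theorem mem_strandPerms_iff_apply_eq {l : Fin n} {σ : Equiv.Perm (Fin n)} :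
    σ ∈ strandPerms n l ↔ σ ∈ strandPerms n (l + 1) ∧ σ l = l := by
  simp only [mem_strandPerms]
  refine ⟨fun h => ⟨fun i hi => h i (by lia), h l le_rfl⟩, fun h i hi => ?_⟩
  rcases eq_or_ne i l with rfl | hil
  · exact h.2
  · exact h.1 i (by grind)

theorem sum_strandPerms_succ {M : Type*} [AddCommMonoid M] (l : Fin n) (A B : M) :
    ∑ σ with σ ∈ strandPerms n (l + 1), (if σ l = l then A else B) =
      (l : ℕ).factorial • A + (l * (l : ℕ).factorial) • B := by
  have hfix : ({σ | σ ∈ strandPerms n (l + 1) ∧ σ l = l} : Finset (Equiv.Perm (Fin n))).card =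
      (l : ℕ).factorial := by
    simpa only [mem_strandPerms_iff_apply_eq] using card_strandPerms (n := n) l.2.le
  have hmove := Finset.card_filter_add_card_filter_not
    (s := ({σ | σ ∈ strandPerms n (l + 1)} : Finset (Equiv.Perm (Fin n)))) fun σ => σ l = l
  rw [Finset.filter_filter, hfix, card_strandPerms l.2, Nat.factorial_succ] at hmove
  rw [Finset.sum_ite, Finset.sum_const, Finset.sum_const, Finset.filter_filter, hfix]
  congr 2
  lia

theorem symProj_sandwich_eq_sum {l : Fin n}
    (hd : ∀ j : ℕ, j + 2 ≤ (l : ℕ) → d ≠ -(2 * (j : K))) :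
    symProj d n l * symProj d n (l + 1) * symProj d n l =
      ∑ σ with σ ∈ strandPerms n (l + 1),
        (symCoeff d (l + 1) (permDiagram σ) •
            (symProj d n l * ofDiagram (permDiagram σ) * symProj d n l) +
          if (partialTranspose l • permDiagram σ).caps.Nonempty then
            symCoeff d (l + 1) (partialTranspose l • permDiagram σ) •
              (symProj d n l * ofDiagram (partialTranspose l • permDiagram σ) * symProj d n l)
          else 0) := by
  rw [symProj.eq_def d n (l + 1), Finset.mul_sum, Finset.sum_mul]
  simp only [mul_smul_comm, smul_mul_assoc]
  refine sum_eq_sum_permDiagram_add_partialTranspose (fun D hD => ?_) fun D hD => ?_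
  · by_contra h
    exact hD (by rw [symCoeff, if_neg h, zero_smul])
  · rw [symProj_sandwich_of_hasTurnback hd l.2.le hD, smul_zero]

theorem symProj_sandwich {p l : Fin n} (hp : (p : ℕ) < l) (hpl : p ≠ l)
    (hd : ∀ j : ℕ, j + 2 ≤ (l : ℕ) → d ≠ -(2 * (j : K))) (hfac : ((l : ℕ).factorial : K) ≠ 0) :
    symProj d n l * symProj d n (l + 1) * symProj d n l =
      (l : ℕ).factorial • ((l + 1 : ℕ).factorial : K)⁻¹ • symProj d n l +
        (l * (l : ℕ).factorial) •
          (((l + 1 : ℕ).factorial : K)⁻¹ •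
              (symProj d n l * ofDiagram (permDiagram (swap p l)) * symProj d n l) +
            weight d (l + 1) 2 •
              (symProj d n l * ofDiagram (hookDiagram p l hpl) * symProj d n l)) := by
  rw [symProj_sandwich_eq_sum hd, ← sum_strandPerms_succ]
  refine Finset.sum_congr rfl fun σ hσ => ?_
  rw [Finset.mem_filter_univ] at hσ
  rw [symCoeff_permDiagram hσ]
  by_cases hσl : σ l = l
  · rw [if_pos hσl, partialTranspose_smul_permDiagram_of_apply_eq hσl, caps_permDiagram,
      if_neg Finset.not_nonempty_empty, add_zero,
      symProj_mul_permDiagram (mem_strandPerms_iff_apply_eq.2 ⟨hσ, hσl⟩),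
      symProj_mul_symProj hd hfac le_rfl l.2.le]
  · have hcard := card_caps_partialTranspose_smul_permDiagram hp hσ hσl
    have hcoeff : symCoeff d (l + 1) (partialTranspose l • permDiagram σ) = weight d (l + 1) 2 := by
      rw [symCoeff, if_pos (partialTranspose_smul_verticalFrom_iff.2
        (Diagram.verticalFrom_permDiagram.2 hσ)), hcard]
    obtain ⟨ρ, hρ, τ, hτ, h⟩ := exists_partialTranspose_smul_permDiagram hp hpl hσ hσl
    rw [if_neg hσl, if_pos (Finset.card_pos.1 (hcard ▸ two_pos)), hcoeff, h,
      symProj_sandwich_sumCongr_smul hρ hτ, symProj_sandwich_permDiagram hp hσ hσl]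

end Sandwich

section Recursion

variable {K : Type*} [Field K] {d : K}

theorem factorial_smul_inv_factorial_succ {m : ℕ} (hfac : ((m + 1).factorial : K) ≠ 0) :
    m.factorial • ((m + 1).factorial : K)⁻¹ = xCoeff K m := by
  rw [Nat.factorial_succ, Nat.cast_mul] at *
  rw [xCoeff, nsmul_eq_mul, mul_inv, mul_left_comm, mul_inv_cancel₀ (right_ne_zero_of_mul hfac),
    mul_one, one_div, Nat.cast_succ]

theorem mul_factorial_smul_inv_factorial_succ {m : ℕ} (hfac : ((m + 1).factorial : K) ≠ 0) :
    (m * m.factorial) • ((m + 1).factorial : K)⁻¹ = zCoeff K m := by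
  rw [mul_smul, factorial_smul_inv_factorial_succ hfac, xCoeff, zCoeff, nsmul_eq_mul, mul_one_div]

theorem weight_two (d : K) (m : ℕ) :
    weight d (m + 1) 2 = -2 / (d + 2 * (m : K) - 2) * ((m + 1).factorial : K)⁻¹ := by
  simp only [weight]
  push_cast
  ring_nf

theorem mul_factorial_smul_weight_two {m : ℕ} (hfac : ((m + 1).factorial : K) ≠ 0) :
    (m * m.factorial) • weight d (m + 1) 2 = yCoeff d m := by
  rw [weight_two, ← mul_smul_comm, mul_factorial_smul_inv_factorial_succ hfac, zCoeff, yCoeff,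
    div_mul_div_comm, neg_mul, mul_comm (d + _ - _)]

theorem symProj_succ {p l : Fin n} (hp : (p : ℕ) < l) (hpl : p ≠ l)
    (hd : ∀ j : ℕ, j + 2 ≤ (l + 1 : ℕ) → d ≠ -(2 * (j : K)))
    (hfac : ((l + 1 : ℕ).factorial : K) ≠ 0) :
    symProj d n (l + 1) = xCoeff K l • symProj d n l +
      yCoeff d l • (symProj d n l * ofDiagram (hookDiagram p l hpl) * symProj d n l) +
      zCoeff K l • (symProj d n l * ofDiagram (permDiagram (swap p l)) * symProj d n l) := by
  have hfac' : ((l : ℕ).factorial : K) ≠ 0 :=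
    ne_zero_of_dvd_ne_zero hfac (Nat.cast_dvd_cast (Nat.factorial_dvd_factorial (Nat.le_succ l)))
  have habsorb : symProj d n l * symProj d n (l + 1) * symProj d n l = symProj d n (l + 1) := by
    rw [symProj_mul_symProj hd hfac' (Nat.le_succ l) l.2,
      symProj_mul_symProj_of_le hd hfac' (Nat.le_succ l) l.2]
  rw [← habsorb, symProj_sandwich hp hpl (fun j hj => hd j (Nat.le_succ_of_le hj)) hfac', smul_add,
    ← smul_assoc, ← smul_assoc, ← smul_assoc, factorial_smul_inv_factorial_succ hfac,
    mul_factorial_smul_inv_factorial_succ hfac, mul_factorial_smul_weight_two hfac]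
  abel

theorem strandPerms_one : strandPerms n 1 = ⊥ := by
  refine (Subgroup.eq_bot_iff_forall _).2 fun σ hσ => Equiv.ext fun i => ?_
  rcases Nat.eq_zero_or_pos (i : ℕ) with hi | hi
  · have := apply_lt_of_mem_strandPerms hσ (hi.trans_lt one_pos)
    exact Fin.ext (by grind [Equiv.Perm.one_apply])
  · exact mem_strandPerms.1 hσ i hi

theorem symProj_one : symProj d n 1 = 1 := by
  rw [symProj, sum_eq_sum_permDiagram (m := 1)]
  · simp only [strandPerms_one, Subgroup.mem_bot, Finset.filter_eq', Finset.mem_univ, if_true,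
      Finset.sum_singleton]
    rw [symCoeff_permDiagram (one_mem _), Nat.factorial_one, Nat.cast_one, inv_one, one_smul]
    rfl
  · intro D hD
    have hv : D.VerticalFrom 1 := by
      by_contra hv
      exact hD (by rw [symCoeff, if_neg hv, zero_smul])
    refine ⟨hv, Finset.not_nonempty_iff_eq_empty.1 fun hcaps => ?_⟩
    obtain ⟨a, b, hab⟩ := Diagram.exists_cap hcaps
    exact absurd ((Diagram.two_le_card_caps hab).trans hv.card_caps_le) (by norm_num)

theorem projStep_eq_symProj {m : ℕ} (hm : 1 ≤ m) (hmn : m ≤ n)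
    (hd : ∀ j : ℕ, j + 2 ≤ m → d ≠ -(2 * (j : K))) (hfac : (m.factorial : K) ≠ 0) :
    projStep d n m = symProj d n m := by
  induction m, hm using Nat.le_induction with
  | base => exact symProj_one.symm
  | succ m hm ih =>
    obtain ⟨i, rfl⟩ := Nat.exists_eq_add_of_le' hm
    have hi : 1 ≤ i + 1 ∧ i + 1 < n := ⟨hm, hmn⟩
    have hfac' : ((i + 1).factorial : K) ≠ 0 :=
      ne_zero_of_dvd_ne_zero hfac (Nat.cast_dvd_cast (Nat.factorial_dvd_factorial (i + 1).le_succ))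
    rw [projStep, ih hi.2.le (fun j hj => hd j (Nat.le_succ_of_le hj)) hfac', e, v, dif_pos hi,
      dif_pos hi]
    exact (symProj_succ (p := ⟨i, by lia⟩) (l := ⟨i + 1, hmn⟩) (Nat.lt_succ_self i) (by simp)
      hd hfac).symm

theorem coeff_proj (hn : 1 ≤ n) (hd : ∀ j : ℕ, j + 2 ≤ n → d ≠ -(2 * (j : K)))
    (hfac : (n.factorial : K) ≠ 0) (D : Diagram n) :
    coeff (proj d n) D = weight d n (n - D.through) := by
  have hv : D.VerticalFrom n := fun x hx => absurd (strandIndex x).2 hx.not_gt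
  rw [proj, projStep_eq_symProj hn le_rfl hd hfac, coeff_symProj, symCoeff, if_pos hv,
    Nat.eq_sub_of_add_eq D.card_caps_add_through]

end Recursion

section CanonicalElement

variable {K : Type*} [Field K] {d : K}

theorem Diagram.through_swap_smul {D : Diagram n} {a b : Fin n} (hab : a ≠ b)
    (ha : D.mate (Sum.inl a) = Sum.inr a) (hb : D.mate (Sum.inl b) = Sum.inr b) :
    (swap (Sum.inl b) (Sum.inr a) • D).through + 2 = D.through := by
  set E := swap (Sum.inl b) (Sum.inr a) • D with hE
  have hb' : D.mate (Sum.inr b) = Sum.inl b := D.mate_eq_comm.1 hb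
  have ha' : D.mate (Sum.inr a) = Sum.inl a := D.mate_eq_comm.1 ha
  have hne : (Sum.inr a : Fin n ⊕ Fin n) ≠ Sum.inr b := by simpa using hab
  have hcap : E.mate (Sum.inl a) = Sum.inl b :=
    E.mate_eq_comm.1 ((swap_smul_mate_right hb' hne).trans ha')
  have hcup : E.mate (Sum.inr a) = Sum.inr b := E.mate_eq_comm.1 (swap_smul_mate hb' hne)
  have hD : D = swap (Sum.inl b) (Sum.inr a) • E := by
    rw [hE, ← mul_smul, Equiv.swap_mul_self, one_smul]
  have hcard := card_caps_swap_smul hcap (Sum.inr a)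
  rw [← hD, hcup, if_pos ⟨rfl, rfl⟩] at hcard
  have := two_le_card_caps hcap
  have := E.card_caps_add_through
  have := D.card_caps_add_through
  lia

theorem canonicalElement_eq_e_mul {k : ℕ} (hk : k + 2 ≤ n) :
    canonicalElement d n k = e d n (k + 1) * canonicalElement d n (k + 2) := by
  rw [canonicalElement, canonicalElement, show (n - k) / 2 = (n - (k + 2)) / 2 + 1 by lia,
    List.range_succ_eq_map, List.map_cons, List.prod_cons, List.map_map, mul_zero, add_zero]
  exact congrArg (fun f => _ * (List.map f _).prod) <| funext fun j =>
    congrArg (e d n) (by simp only [Nat.succ_eq_add_one]; ring)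

theorem canonicalElement_self : canonicalElement d n n = 1 := by
  rw [canonicalElement, Nat.sub_self, Nat.zero_div, List.range_zero, List.map_nil, List.prod_nil]

theorem exists_canonicalElement_eq_ofDiagram {k r : ℕ} (hk : k + 2 * r = n) :
    ∃ D : Diagram n, canonicalElement d n k = ofDiagram D ∧ D.through = k ∧
      ∀ i : Fin n, (i : ℕ) < k → D.mate (Sum.inl i) = Sum.inr i := by
  induction r generalizing k with
  | zero =>
    obtain rfl : k = n := hk
    refine ⟨permDiagram 1, canonicalElement_self, ?_, fun i _ => rfl⟩
    simpa only [caps_permDiagram, Finset.card_empty, zero_add] using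
      (permDiagram (1 : Equiv.Perm (Fin k))).card_caps_add_through
  | succ r ih =>
    obtain ⟨D, hD, hthrough, hvert⟩ := ih (k := k + 2) (by lia)
    have hi : 1 ≤ k + 1 ∧ k + 1 < n := by lia
    let a : Fin n := ⟨k, by lia⟩
    let b : Fin n := ⟨k + 1, hi.2⟩
    have hab : a ≠ b := by simp [a, b]
    have ha : D.mate (Sum.inl a) = Sum.inr a := hvert a (by simp [a])
    have hb : D.mate (Sum.inl b) = Sum.inr b := hvert b (by simp [b])
    have he : e d n (k + 1) = ofDiagram (hookDiagram a b hab) := by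
      rw [e, dif_pos hi]
      rfl
    refine ⟨swap (Sum.inl b) (Sum.inr a) • D, ?_, ?_, fun i hik => ?_⟩
    · rw [canonicalElement_eq_e_mul hi.2, hD, he, ofDiagram_mul_ofDiagram,
        loops_hookDiagram_of_ne hab D (ha ▸ Sum.inr_ne_inl), pow_zero, one_smul, comp_hookDiagram,
        ha]
    · exact Nat.add_right_cancel ((Diagram.through_swap_smul hab ha hb).trans hthrough)
    · have hia : i ≠ a := fun h => hik.ne (congrArg Fin.val h)
      have hib : i ≠ b := fun h => (Nat.lt_succ_of_lt hik).ne (congrArg Fin.val h)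
      rw [swap_smul_mate_of_ne (D.mate_eq_comm.1 hb) Sum.inl_ne_inr (by simpa using hib)
        Sum.inl_ne_inr (by simpa [D.mate_eq_comm.1 ha] using hia), hvert i (by lia)]

theorem isCommonCoeff_proj {k r : ℕ} (hn : 1 ≤ n) (hk : k + 2 * r = n)
    (hd : ∀ j : ℕ, j + 2 ≤ n → d ≠ -(2 * (j : K))) (hfac : (n.factorial : K) ≠ 0) :
    IsCommonCoeff (proj d n) k (weight d n (2 * r)) := by
  obtain ⟨X, -, hX, -⟩ := exists_canonicalElement_eq_ofDiagram (d := d) hk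
  refine ⟨⟨X, hX⟩, fun Y hY => ?_⟩
  rw [coeff_proj hn hd hfac, hY, ← hk, Nat.add_sub_cancel_left]

end CanonicalElement

end VirtualTL

open VirtualTL in
theorem mainTheorem4_general {K : Type*} [Field K] (d : K) (n k : ℕ)
    (hk : k + 2 ≤ n) (hpar : Even (n - k)) (hn : (n.factorial : K) ≠ 0)
    (hd : ∀ j : ℕ, j + 2 ≤ n → d ≠ -(2 * (j : K))) :
    ∃ (D : Diagram n) (c : K),
      (canonicalElement d n k = ofDiagram D) ∧
      D.through = k ∧
      IsCommonCoeff (proj d (n - 1)) (k + 1) c ∧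
      coeff (proj d n) D =
        (((n - k) / 2 : ℕ) : K) * (-2 / ((n : K) * (d + 2 * (n : K) - 4))) * c := by
  obtain ⟨r, hr⟩ := hpar
  obtain ⟨j, rfl⟩ := Nat.exists_eq_add_of_le' (show 1 ≤ r by lia)
  obtain ⟨m, rfl⟩ := Nat.exists_eq_add_of_le' (show 1 ≤ n by lia)
  obtain ⟨D, hD, hDk, -⟩ := exists_canonicalElement_eq_ofDiagram (d := d)
    (show k + 2 * (j + 1) = m + 1 by lia)
  have hm : (m.factorial : K) ≠ 0 :=
    ne_zero_of_dvd_ne_zero hn (Nat.cast_dvd_cast (Nat.factorial_dvd_factorial m.le_succ))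
  have hcommon : IsCommonCoeff (proj d m) (k + 1) (weight d m (2 * j)) :=
    isCommonCoeff_proj (by lia) (by lia) (fun i hi => hd i (Nat.le_succ_of_le hi)) hm
  refine ⟨D, weight d m (2 * j), hD, hDk, hcommon, ?_⟩
  rw [coeff_proj m.succ_pos hd hn, hDk, show m + 1 - k = 2 * (j + 1) by lia,
    weight_succ_two_mul_succ, Nat.mul_div_cancel_left _ two_pos]

theorem mainTheorem4 {K : Type*} [Field K] [CharZero K] (d : K) (n k : ℕ)
    (hk : k + 2 ≤ n) (hpar : Even (n - k))
    (hd : ∀ j : ℕ, j + 2 ≤ n → d ≠ -(2 * (j : K))) :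
    ∃ (D : VirtualTL.Diagram n) (c : K),
      (VirtualTL.canonicalElement d n k = VirtualTL.ofDiagram D) ∧
      D.through = k ∧
      VirtualTL.IsCommonCoeff (VirtualTL.proj d (n - 1)) (k + 1) c ∧
      VirtualTL.coeff (VirtualTL.proj d n) D =
        (((n - k) / 2 : ℕ) : K) * (-2 / ((n : K) * (d + 2 * (n : K) - 4))) * c :=
  mainTheorem4_general d n k hk hpar (Nat.cast_ne_zero.2 n.factorial_ne_zero) hd
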